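/- Let $n\ge 1$, let $\Omega\subset\mathbb{C}^n$ be a bounded domain, let $f:\overline\Omega\to\mathbb{R}$ be continuous and positive, and let $\varphi:\partial\Omega\to\mathbb{R}$ be continuous. Write $D^2_{\mathbb C}\psi=\left(\frac{\partial^2\psi}{\partial z_j\partial\bar z_k}\right)_{1\le j,k\le n}$ for the complex Hessian and $\Lambda_1$ for the smallest eigenvalue of a Hermitian matrix, and consider the equation $$\Lambda_1(D^2_{\mathbb C}u)=f\quad\text{in }\Omega. \tag{1}$$ An upper semicontinuous function $u:\Omega\to\mathbb{R}\cup\{-\infty\}$, $u\not\equiv-\infty$, is a (viscosity) subsolution of (1) if $\Lambda_1(D^2_{\mathbb C}\psi)(z_0)\ge f(z_0)$ whenever $z_0\in\Omega$, $\psi$ is real-valued and $C^2$ near $z_0$, $\psi(z_0)=u(z_0)$ and $\psi\ge u$ near $z_0$. A lower semicontinuous function $u:\Omega\to\mathbb{R}\cup\{+\infty\}$, $u\not\equiv+\infty$, is a (viscosity) supersolution of (1) if $\max\{\Lambda_1(D^2_{\mathbb C}\psi)(z_0),0\}\le f(z_0)$ whenever $z_0\in\Omega$, $\psi$ is real-valued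 and $C^2$ near $z_0$, $\psi(z_0)=u(z_0)$ and $\psi\le u$ near $z_0$. A viscosity solution of (1) is a function $u:\Omega\to\mathbb{R}$ that is both a subsolution and a supersolution. For a function $u$ on $\Omega$ and $z\in\overline\Omega$ put $$u^*(z)=\inf_{r>0}\ \sup_{\Omega\cap \mathbb{B}(z,r)}u,\qquad u_*(z)=\sup_{r>0}\ \inf_{\Omega\cap \mathbb{B}(z,r)}u .$$ Let $\underline\phi$ be a subsolution and $\overline\phi$ a supersolution of (1) such that $$\underline\phi_*=\overline\phi^*=\varphi\quad\text{and}\quad \underline\phi^*\le\overline\phi_*\qquad\text{on }\partial\Omega .$$ Then the envelope $$u(z):=\sup\{v(z):\ v \text{ is a bounded upper semicontinuous subsolution of (1) with } \underline\phi\le v\le\overline\phi \text{ in }\Omega\},\qquad z\in\Omega,$$ is a viscosity solution of (1) with $u=\varphi$ on $\partial\Omega$, in the sense that $\lim_{\Omega\ni z\to\zeta}u(z)=\varphi(\zeta)$ for every $\zeta\in\partial\Omega$; and it is the only viscosity solution of (1) with these boundary values. -/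

import Mathlib

open Filter Topology

noncomputable section

namespace FirstEigenvalue

/-- `ℂⁿ` with its Euclidean norm. -/
abbrev Cn (n : ℕ) : Type := EuclideanSpace ℂ (Fin n)

/-- The second real Fréchet derivative `D²ψ(z)(a, b)` of a real function on `ℂⁿ ≅ ℝ²ⁿ`. -/
def secondDeriv {n : ℕ} (ψ : Cn n → ℝ) (z a b : Cn n) : ℝ :=
  fderiv ℝ (fderiv ℝ ψ) z a b

/-- The complex Hessian `(∂²ψ / ∂z_j ∂z̄_k)_{j,k}`, where with `z_j = x_j + i y_j`
`∂²/∂z_j∂z̄_k = ¼ (∂_{x_j} - i ∂_{y_j}) (∂_{x_k} + i ∂_{y_k})`.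
The directions of `x_j` and `y_j` are `single j 1` and `single j I`. -/
def complexHessian {n : ℕ} (ψ : Cn n → ℝ) (z : Cn n) : Matrix (Fin n) (Fin n) ℂ :=
  Matrix.of fun j k =>
    let ex : Fin n → Cn n := fun l => EuclideanSpace.single l 1
    let ey : Fin n → Cn n := fun l => EuclideanSpace.single l Complex.I
    (1 / 4 : ℂ) *
      (((secondDeriv ψ z (ex j) (ex k) + secondDeriv ψ z (ey j) (ey k) : ℝ) : ℂ) +
        Complex.I *
          ((secondDeriv ψ z (ex j) (ey k) - secondDeriv ψ z (ey j) (ex k) : ℝ) : ℂ))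

/-- The smallest eigenvalue of a Hermitian matrix (of size at least one). -/
def lambdaOne {n : ℕ} (A : Matrix (Fin n) (Fin n) ℂ) : ℝ :=
  sInf (spectrum ℝ A)

/-- `ψ` is `C²` near `z₀` and touches `u` from above at `z₀`. -/
def TouchesAbove {n : ℕ} (ψ : Cn n → ℝ) (u : Cn n → EReal) (z₀ : Cn n) : Prop :=
  ContDiffAt ℝ 2 ψ z₀ ∧ (ψ z₀ : EReal) = u z₀ ∧ ∀ᶠ z in 𝓝 z₀, u z ≤ (ψ z : EReal)

/-- `ψ` is `C²` near `z₀` and touches `u` from below at `z₀`. -/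
def TouchesBelow {n : ℕ} (ψ : Cn n → ℝ) (u : Cn n → EReal) (z₀ : Cn n) : Prop :=
  ContDiffAt ℝ 2 ψ z₀ ∧ (ψ z₀ : EReal) = u z₀ ∧ ∀ᶠ z in 𝓝 z₀, (ψ z : EReal) ≤ u z

/-- Viscosity subsolutions `u : Ω → ℝ ∪ {-∞}` of `Λ₁(D²_ℂ u) = f` in the open set `Ω`.
Only the values of `u` on `Ω` matter. -/
structure IsSubsolution {n : ℕ} (Ω : Set (Cn n)) (f : Cn n → ℝ) (u : Cn n → EReal) :
    Prop where
  usc : UpperSemicontinuousOn u Ω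
  ne_top : ∀ z ∈ Ω, u z ≠ ⊤
  proper : ∃ z ∈ Ω, u z ≠ ⊥
  test : ∀ z₀ ∈ Ω, ∀ ψ : Cn n → ℝ, TouchesAbove ψ u z₀ →
    f z₀ ≤ lambdaOne (complexHessian ψ z₀)

/-- Viscosity supersolutions `u : Ω → ℝ ∪ {+∞}` of `Λ₁(D²_ℂ u) = f` in the open set `Ω`. -/
structure IsSupersolution {n : ℕ} (Ω : Set (Cn n)) (f : Cn n → ℝ) (u : Cn n → EReal) :
    Prop where
  lsc : LowerSemicontinuousOn u Ω
  ne_bot : ∀ z ∈ Ω, u z ≠ ⊥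
  proper : ∃ z ∈ Ω, u z ≠ ⊤
  test : ∀ z₀ ∈ Ω, ∀ ψ : Cn n → ℝ, TouchesBelow ψ u z₀ →
    max (lambdaOne (complexHessian ψ z₀)) 0 ≤ f z₀

/-- Viscosity solutions: both sub- and supersolutions (hence real-valued on `Ω`). -/
def IsSolution {n : ℕ} (Ω : Set (Cn n)) (f : Cn n → ℝ) (u : Cn n → EReal) : Prop :=
  IsSubsolution Ω f u ∧ IsSupersolution Ω f u

/-- The upper envelope `u^*(z) = inf_{r>0} sup {u(y) : y ∈ Ω ∩ B(z, r)}` of a function on `Ω`. -/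
def uscEnvelope {n : ℕ} (Ω : Set (Cn n)) (u : Cn n → EReal) (z : Cn n) : EReal :=
  ⨅ r : ℝ, ⨅ _ : 0 < r, ⨆ y ∈ Ω ∩ Metric.ball z r, u y

/-- The lower envelope `u_*(z) = sup_{r>0} inf {u(y) : y ∈ Ω ∩ B(z, r)}` of a function on `Ω`. -/
def lscEnvelope {n : ℕ} (Ω : Set (Cn n)) (u : Cn n → EReal) (z : Cn n) : EReal :=
  ⨆ r : ℝ, ⨆ _ : 0 < r, ⨅ y ∈ Ω ∩ Metric.ball z r, u y

/-- The bounded (upper semicontinuous) subsolutions `v` with `lo ≤ v ≤ hi` in `Ω`. -/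
def perronFamily {n : ℕ} (Ω : Set (Cn n)) (f : Cn n → ℝ) (lo hi : Cn n → EReal) :
    Set (Cn n → EReal) :=
  {v | IsSubsolution Ω f v ∧
    (∃ M : ℝ, ∀ z ∈ Ω, ((-M : ℝ) : EReal) ≤ v z ∧ v z ≤ (M : EReal)) ∧
    ∀ z ∈ Ω, lo z ≤ v z ∧ v z ≤ hi z}

/-- The pointwise supremum of the family of subsolutions above. -/
def perronEnvelope {n : ℕ} (Ω : Set (Cn n)) (f : Cn n → ℝ) (lo hi : Cn n → EReal)
    (z : Cn n) : EReal :=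
  ⨆ v ∈ perronFamily Ω f lo hi, v z

/-- `u = φ` on `∂Ω`: `u` extends continuously to `∂Ω` with boundary values `φ`. -/
def HasBoundaryValues {n : ℕ} (Ω : Set (Cn n)) (u : Cn n → EReal) (φ : Cn n → ℝ) : Prop :=
  ∀ ζ ∈ frontier Ω, Tendsto u (𝓝[Ω] ζ) (𝓝 (φ ζ : EReal))

end FirstEigenvalue

end

/-! The condition `Λ₁ ≥ c` says that the Levi form is at least `c ‖ξ‖²` for every `ξ`
(`le_lambdaOne_iff`). Each single direction gives a linear condition, and this linearity lets
subsolutions be smoothed by averaging, so that comparison needs no doubling of variables.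

A Lipschitz function whose upper test functions have Levi form at least `c` satisfies `w(z) + c r²
≤` its mean over the circle of radius `r` in every complex line through `z`
(`le_circleAverage_of_leviGe`). Circle inequalities survive mollification, and for a smooth function
they give back the Levi bound. A bounded subsolution is therefore first made Lipschitz by a
sup-convolution and then mollified (`exists_smooth_approx`).

Comparison (`le_of_isSupersolution`): adding `η ‖z‖²` makes the subsolution strict. If it exceeded
the supersolution `v` somewhere, a vertical translate of a smooth approximant would touch `v` from
below at an interior point, with smallest eigenvalue above `f`.

Perron: the inequalities at `∂Ω` force both barriers to tend to `φ`. The upper envelope of the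
Perron supremum `U` is a subsolution and by comparison stays below `hi`, so it belongs to the family
and equals `U`. If the lower envelope of `U` failed to be a supersolution, a small smooth bump would
enlarge `U` within the family. Comparison between `U` and its lower envelope gives equality, so `U`
is a solution; comparison once more gives uniqueness. -/

noncomputable section

namespace FirstEigenvalue

open MeasureTheory

variable {n : ℕ}

/-! ### The Levi form and the smallest eigenvalue of the complex Hessian -/

/-- The Levi form `∑ ψ_{j k̄} ξ_j ξ̄_k`, written through the real second derivative. -/
def levi (ψ : Cn n → ℝ) (z ξ : Cn n) : ℝ :=
  (secondDeriv ψ z ξ ξ + secondDeriv ψ z (Complex.I • ξ) (Complex.I • ξ)) / 4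

/-! ### Second derivatives of affine compositions, linear combinations and the squared norm. -/

section SecondDerivative

variable {E F : Type*} [NormedAddCommGroup E] [NormedSpace ℝ E]
  [NormedAddCommGroup F] [NormedSpace ℝ F]

lemma differentiableAt_fderiv_of_contDiffAt_two {G : E → ℝ} {z : E} (hG : ContDiffAt ℝ 2 G z) :
    DifferentiableAt ℝ (fderiv ℝ G) z :=
  (hG.fderiv_right (m := 1) (by norm_num)).differentiableAt (by norm_num)

lemma eventually_differentiableAt_of_contDiffAt_two {G : E → ℝ} {z : E}
    (hG : ContDiffAt ℝ 2 G z) : ∀ᶠ x in 𝓝 z, DifferentiableAt ℝ G x :=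
  (hG.eventually (by simp)).mono fun _ hx => hx.differentiableAt (by norm_num)

lemma fderiv_fderiv_comp_affine (L : E →L[ℝ] F) (b : F) {G : F → ℝ} {z : E}
    (hG : ContDiffAt ℝ 2 G (L z + b)) (u v : E) :
    fderiv ℝ (fderiv ℝ (fun x => G (L x + b))) z u v =
      fderiv ℝ (fderiv ℝ G) (L z + b) (L u) (L v) := by
  have hA : ∀ x, HasFDerivAt (fun x => L x + b) L x := fun x => L.hasFDerivAt.add_const b
  have hc : Tendsto (fun x => L x + b) (𝓝 z) (𝓝 (L z + b)) := (hA z).continuousAt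
  have h1 : fderiv ℝ (fun x => G (L x + b)) =ᶠ[𝓝 z]
      fun x => (fderiv ℝ G (L x + b)).comp L := by
    filter_upwards [hc.eventually (eventually_differentiableAt_of_contDiffAt_two hG)] with x hx
    exact (hx.hasFDerivAt.comp x (hA x)).fderiv
  have h2 : HasFDerivAt (fun x => fderiv ℝ G (L x + b))
      ((fderiv ℝ (fderiv ℝ G) (L z + b)).comp L) z :=
    (differentiableAt_fderiv_of_contDiffAt_two hG).hasFDerivAt.comp z (hA z)
  rw [h1.fderiv_eq, (h2.clm_comp (hasFDerivAt_const L z)).fderiv]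
  simp

lemma fderiv_fderiv_add {G H : E → ℝ} {z : E} (hG : ContDiffAt ℝ 2 G z)
    (hH : ContDiffAt ℝ 2 H z) :
    fderiv ℝ (fderiv ℝ (fun x => G x + H x)) z =
      fderiv ℝ (fderiv ℝ G) z + fderiv ℝ (fderiv ℝ H) z := by
  have h1 : fderiv ℝ (fun x => G x + H x) =ᶠ[𝓝 z] fun x => fderiv ℝ G x + fderiv ℝ H x := by
    filter_upwards [eventually_differentiableAt_of_contDiffAt_two hG,
      eventually_differentiableAt_of_contDiffAt_two hH] with x hx hx'
    exact fderiv_fun_add hx hx'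
  rw [h1.fderiv_eq]
  exact fderiv_fun_add (differentiableAt_fderiv_of_contDiffAt_two hG)
    (differentiableAt_fderiv_of_contDiffAt_two hH)

lemma fderiv_fderiv_const_mul (c : ℝ) {G : E → ℝ} {z : E} (hG : ContDiffAt ℝ 2 G z) :
    fderiv ℝ (fderiv ℝ (fun x => c * G x)) z = c • fderiv ℝ (fderiv ℝ G) z := by
  have h1 : fderiv ℝ (fun x => c * G x) =ᶠ[𝓝 z] fun x => c • fderiv ℝ G x := by
    filter_upwards [eventually_differentiableAt_of_contDiffAt_two hG] with x hx
    exact fderiv_const_mul hx c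
  rw [h1.fderiv_eq]
  exact fderiv_fun_const_smul (differentiableAt_fderiv_of_contDiffAt_two hG) c

lemma fderiv_fderiv_norm_sq {V : Type*} [NormedAddCommGroup V] [InnerProductSpace ℝ V]
    (z u : V) : fderiv ℝ (fderiv ℝ (fun x : V => ‖x‖ ^ 2)) z u u = 2 * ‖u‖ ^ 2 := by
  have h1 : fderiv ℝ (fun x : V => ‖x‖ ^ 2) = fun x => ((2 : ℝ) • innerSL ℝ) x := by
    funext x
    rw [(hasStrictFDerivAt_norm_sq x).hasFDerivAt.fderiv]
    ext v
    simp [two_mul]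
  rw [h1, ContinuousLinearMap.fderiv]
  change 2 * inner ℝ u u = 2 * ‖u‖ ^ 2
  rw [real_inner_self_eq_norm_sq]

end SecondDerivative

lemma levi_add {ψ χ : Cn n → ℝ} {z : Cn n} (hψ : ContDiffAt ℝ 2 ψ z) (hχ : ContDiffAt ℝ 2 χ z)
    (ξ : Cn n) : levi (fun x => ψ x + χ x) z ξ = levi ψ z ξ + levi χ z ξ := by
  simp only [levi, secondDeriv, fderiv_fderiv_add hψ hχ, add_apply]
  ring

lemma levi_const_mul (c : ℝ) {ψ : Cn n → ℝ} {z : Cn n} (hψ : ContDiffAt ℝ 2 ψ z)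
    (ξ : Cn n) : levi (fun x => c * ψ x) z ξ = c * levi ψ z ξ := by
  simp only [levi, secondDeriv, fderiv_fderiv_const_mul c hψ, smul_apply, smul_eq_mul]
  ring

lemma levi_add_const (ψ : Cn n → ℝ) (c : ℝ) (z ξ : Cn n) :
    levi (fun x => ψ x + c) z ξ = levi ψ z ξ := by
  have : fderiv ℝ (fun x => ψ x + c) = fderiv ℝ ψ := by
    funext x
    exact fderiv_add_const c
  simp only [levi, secondDeriv, this]

lemma levi_comp_add (ψ : Cn n → ℝ) (a z ξ : Cn n) :
    levi (fun x => ψ (x + a)) z ξ = levi ψ (z + a) ξ := by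
  have : fderiv ℝ (fun x => ψ (x + a)) = fun x => fderiv ℝ ψ (x + a) := by
    funext x
    exact fderiv_comp_add_right a
  simp only [levi, secondDeriv, this, fderiv_comp_add_right]

lemma levi_comp_affine {V : Type*} [NormedAddCommGroup V] [NormedSpace ℂ V]
    (L : Cn n →L[ℂ] V) (b : V) {G : V → ℝ} {z : Cn n}
    (hG : ContDiffAt ℝ 2 G (L z + b)) (ξ : Cn n) :
    levi (fun x => G (L x + b)) z ξ =
      (fderiv ℝ (fderiv ℝ G) (L z + b) (L ξ) (L ξ) +
        fderiv ℝ (fderiv ℝ G) (L z + b) (Complex.I • L ξ) (Complex.I • L ξ)) / 4 := by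
  have h := fderiv_fderiv_comp_affine (L.restrictScalars ℝ) b (G := G) (z := z) hG
  simp only [ContinuousLinearMap.coe_restrictScalars'] at h
  simp only [levi, secondDeriv, h, map_smul]

lemma levi_norm_affine_sq {V : Type*} [NormedAddCommGroup V] [InnerProductSpace ℂ V]
    (L : Cn n →L[ℂ] V) (b : V) (z ξ : Cn n) :
    levi (fun x => ‖L x + b‖ ^ 2) z ξ = ‖L ξ‖ ^ 2 := by
  let _ := InnerProductSpace.complexToReal (G := V)
  have h : ContDiff ℝ 2 fun x : V => ‖x‖ ^ 2 := contDiff_norm_sq ℝ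
  rw [levi_comp_affine L b h.contDiffAt]
  simp only [fderiv_fderiv_norm_sq, norm_smul, Complex.norm_I, one_mul]
  ring

lemma levi_norm_sub_sq (a z ξ : Cn n) : levi (fun x => ‖x - a‖ ^ 2) z ξ = ‖ξ‖ ^ 2 := by
  simpa [sub_eq_add_neg] using levi_norm_affine_sq (ContinuousLinearMap.id ℂ (Cn n)) (-a) z ξ

lemma contDiff_norm_sub_sq (a : Cn n) : ContDiff ℝ 2 fun x : Cn n => ‖x - a‖ ^ 2 := by
  let _ := InnerProductSpace.complexToReal (G := Cn n)
  exact (contDiff_norm_sq ℝ).comp (contDiff_id.sub contDiff_const)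

/-! ### The complex Hessian as a Hermitian matrix and its smallest eigenvalue. -/

lemma secondDeriv_comm {ψ : Cn n → ℝ} {z : Cn n} (hψ : ContDiffAt ℝ 2 ψ z) (a b : Cn n) :
    secondDeriv ψ z a b = secondDeriv ψ z b a :=
  hψ.isSymmSndFDerivAt (by simp) a b

/-- The Levi form polarized to a sesquilinear form, linear in the first variable. -/
def leviSesq (ψ : Cn n → ℝ) (z : Cn n) : Cn n →ₗ[ℂ] Cn n →ₛₗ[starRingEnd ℂ] ℂ :=
  LinearMap.mk₂'ₛₗ (RingHom.id ℂ) (starRingEnd ℂ)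
    (fun a b => ((secondDeriv ψ z a b + secondDeriv ψ z (Complex.I • a) (Complex.I • b) : ℝ) : ℂ) +
      Complex.I * ((secondDeriv ψ z a (Complex.I • b) -
        secondDeriv ψ z (Complex.I • a) b : ℝ) : ℂ))
    (fun a a' b => by
      simp only [secondDeriv, smul_add, map_add, add_apply]
      push_cast
      ring)
    (fun c a b => by
      have h1 : c • a = c.re • a + c.im • (Complex.I • a) := by
        conv_lhs => rw [← Complex.re_add_im c]
        rw [add_smul, mul_smul]
        rfl
      have h2 : Complex.I • c • a = c.re • (Complex.I • a) - c.im • a := by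
        rw [h1, smul_add, smul_comm Complex.I c.im, smul_smul Complex.I Complex.I a,
          Complex.I_mul_I, smul_comm Complex.I c.re]
        simp [sub_eq_add_neg]
      rw [h2, h1]
      simp only [secondDeriv, map_add, map_sub, map_smul, add_apply, sub_apply,
        smul_apply, smul_eq_mul, RingHom.id_apply]
      apply Complex.ext <;> simp <;> ring)
    (fun a b b' => by
      simp only [secondDeriv, smul_add, map_add]
      push_cast
      ring)
    (fun c a b => by
      have h1 : c • b = c.re • b + c.im • (Complex.I • b) := by
        conv_lhs => rw [← Complex.re_add_im c]
        rw [add_smul, mul_smul]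
        rfl
      have h2 : Complex.I • c • b = c.re • (Complex.I • b) - c.im • b := by
        rw [h1, smul_add, smul_comm Complex.I c.im, smul_smul Complex.I Complex.I b,
          Complex.I_mul_I, smul_comm Complex.I c.re]
        simp [sub_eq_add_neg]
      rw [h2, h1]
      simp only [secondDeriv, map_add, map_sub, map_smul, smul_eq_mul]
      apply Complex.ext <;> simp <;> ring)

lemma leviSesq_self {ψ : Cn n → ℝ} {z : Cn n} (hψ : ContDiffAt ℝ 2 ψ z) (ξ : Cn n) :
    leviSesq ψ z ξ ξ = 4 * (levi ψ z ξ : ℂ) := by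
  simp only [leviSesq, LinearMap.mk₂'ₛₗ_apply, levi, secondDeriv_comm hψ ξ (Complex.I • ξ),
    sub_self]
  push_cast
  ring

lemma complexHessian_apply (ψ : Cn n → ℝ) (z : Cn n) (j k : Fin n) :
    complexHessian ψ z j k =
      1 / 4 * leviSesq ψ z (EuclideanSpace.single j 1) (EuclideanSpace.single k 1) := by
  have h : ∀ l : Fin n, Complex.I • (EuclideanSpace.single l 1 : Cn n) =
      EuclideanSpace.single l Complex.I := fun l => by
    ext i; simp
  simp [complexHessian, leviSesq, h]

lemma complexHessian_isHermitian {ψ : Cn n → ℝ} {z : Cn n} (hψ : ContDiffAt ℝ 2 ψ z) :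
    (complexHessian ψ z).IsHermitian := by
  ext j k
  have := secondDeriv_comm hψ
  simp only [complexHessian, Matrix.conjTranspose_apply, Matrix.of_apply]
  rw [this (EuclideanSpace.single k 1) (EuclideanSpace.single j 1),
    this (EuclideanSpace.single k Complex.I) (EuclideanSpace.single j Complex.I),
    this (EuclideanSpace.single k Complex.I) (EuclideanSpace.single j 1),
    this (EuclideanSpace.single k 1) (EuclideanSpace.single j Complex.I)]
  apply Complex.ext <;> simp

/-- The Levi form pairs `ψ_{j k̄}` with `ξ_j ξ̄_k`, while the matrix form pairs it with `x̄_j x_k`;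
hence `ξ = star x`. Expanding `ξ` in the standard basis by sesquilinearity gives the entries. -/
lemma complexHessian_quadraticForm {ψ : Cn n → ℝ} {z : Cn n} (hψ : ContDiffAt ℝ 2 ψ z)
    (x : Fin n → ℂ) :
    star x ⬝ᵥ (complexHessian ψ z).mulVec x = (levi ψ z (WithLp.toLp 2 (star x)) : ℂ) := by
  have hsum : (WithLp.toLp 2 (star x) : Cn n) =
      ∑ j, star (x j) • (EuclideanSpace.single j 1 : Cn n) := by
    ext i
    simp [Pi.single_apply]
  have h := leviSesq_self hψ (WithLp.toLp 2 (star x))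
  have h' : (levi ψ z (WithLp.toLp 2 (star x)) : ℂ) =
      1 / 4 * leviSesq ψ z (WithLp.toLp 2 (star x)) (WithLp.toLp 2 (star x)) := by
    rw [h]; ring
  rw [h', hsum]
  simp only [map_sum, map_smul, LinearMap.sum_apply, LinearMap.smul_apply, dotProduct,
    Matrix.mulVec, complexHessian_apply, Finset.mul_sum, LinearMap.map_smulₛₗ, Finset.smul_sum]
  rw [Finset.sum_comm]
  refine Finset.sum_congr rfl fun j _ => Finset.sum_congr rfl fun k _ => ?_
  simp
  ring

-- All eigenvalues are at least `c` exactly when the Hessian minus `c` is positive semidefinite,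
-- which is read off its quadratic form. `1 ≤ n` makes the spectrum nonempty, so that its `sInf` is
-- a genuine minimum.
open scoped ComplexOrder Pointwise in
lemma le_lambdaOne_iff (hn : 1 ≤ n) {ψ : Cn n → ℝ} {z : Cn n} (hψ : ContDiffAt ℝ 2 ψ z)
    (c : ℝ) :
    c ≤ lambdaOne (complexHessian ψ z) ↔ ∀ ξ : Cn n, c * ‖ξ‖ ^ 2 ≤ levi ψ z ξ := by
  have : Nonempty (Fin n) := ⟨⟨0, hn⟩⟩
  have hA := complexHessian_isHermitian hψ
  set A := complexHessian ψ z
  set B := A - algebraMap ℝ _ c with hB_def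
  have hB : B.IsHermitian := by
    rw [hB_def, Algebra.algebraMap_eq_smul_one]
    refine hA.sub ?_
    rw [Matrix.IsHermitian, Matrix.conjTranspose_smul, Matrix.conjTranspose_one, star_trivial]
  have hspec : c ≤ lambdaOne A ↔ B.PosSemidef := by
    rw [hB.posSemidef_iff_eigenvalues_nonneg, lambdaOne,
      le_csInf_iff (Matrix.finite_real_spectrum).bddBelow
        (hA.spectrum_real_eq_range_eigenvalues ▸ Set.range_nonempty _)]
    have h1 : spectrum ℝ B = spectrum ℝ A - {c} := (spectrum.sub_singleton_eq A c).symm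
    rw [hB.spectrum_real_eq_range_eigenvalues] at h1
    constructor
    · intro h i
      have hi : hB.eigenvalues i ∈ spectrum ℝ A - {c} := h1 ▸ Set.mem_range_self i
      simp only [Set.sub_singleton, Set.mem_image] at hi
      obtain ⟨x, hx, hxi⟩ := hi
      simpa [← hxi] using h x hx
    · intro h x hx
      have : x - c ∈ Set.range hB.eigenvalues := by
        rw [h1, Set.sub_singleton]
        exact Set.mem_image_of_mem _ hx
      obtain ⟨i, hi⟩ := this
      have := h i
      simp only [Pi.zero_apply, hi] at this
      linarith
  have hquad : ∀ x : Fin n → ℂ, star x ⬝ᵥ B.mulVec x =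
      ((levi ψ z (WithLp.toLp 2 (star x)) - c * ‖(WithLp.toLp 2 (star x) : Cn n)‖ ^ 2 : ℝ) : ℂ) := by
    intro x
    have hx : (star x ⬝ᵥ x : ℂ) = ((‖(WithLp.toLp 2 (star x) : Cn n)‖ ^ 2 : ℝ) : ℂ) := by
      simp only [EuclideanSpace.norm_sq_eq, dotProduct, Pi.star_apply, norm_star]
      push_cast
      refine Finset.sum_congr rfl fun i _ => ?_
      exact Complex.conj_mul' (x i)
    rw [hB_def, Matrix.sub_mulVec, dotProduct_sub, complexHessian_quadraticForm hψ,
      Algebra.algebraMap_eq_smul_one, Matrix.smul_mulVec, Matrix.one_mulVec, dotProduct_smul, hx]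
    simp
  rw [hspec, Matrix.posSemidef_iff_dotProduct_mulVec]
  constructor
  · rintro ⟨-, h⟩ ξ
    have := h (star ξ.ofLp)
    rw [hquad, star_star, Complex.zero_le_real] at this
    simpa using this
  · refine fun h => ⟨hB, fun x => ?_⟩
    rw [hquad, Complex.zero_le_real]
    simpa using h (WithLp.toLp 2 (star x))

/-! ### The mean value inequality for Lipschitz viscosity subsolutions -/

/-- Every `C²` function touching `w` from above at `x` has Levi form at least `c ‖·‖²` there. -/
def LeviGe (w : Cn n → ℝ) (x : Cn n) (c : ℝ) : Prop :=
  ∀ ψ : Cn n → ℝ, ContDiffAt ℝ 2 ψ x → ψ x = w x → (∀ᶠ y in 𝓝 x, w y ≤ ψ y) →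
    ∀ ξ : Cn n, c * ‖ξ‖ ^ 2 ≤ levi ψ x ξ

/-- A continuous function on a circle is a uniform limit of real parts of entire functions. -/
lemma exists_entire_re_approx {h : ℂ → ℝ} (hh : Continuous h) {r : ℝ} (hr : 0 < r) {ε : ℝ}
    (hε : 0 < ε) :
    ∃ P : ℂ → ℂ, Differentiable ℂ P ∧ ∀ ζ, ‖ζ‖ = r → |(P ζ).re - h ζ| < ε := by
  have : Fact (0 < (1 : ℝ)) := ⟨one_pos⟩
  let H : C(AddCircle (1 : ℝ), ℂ) :=
    ⟨fun θ => (h (r * AddCircle.toCircle θ) : ℂ), by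
      have := AddCircle.continuous_toCircle (T := (1 : ℝ))
      fun_prop⟩
  have hH : H ∈ (Submodule.span ℂ (Set.range (@fourier (1 : ℝ)))).topologicalClosure := by
    rw [span_fourier_closure_eq_top]
    trivial
  obtain ⟨F, hF, hFH⟩ := Metric.mem_closure_iff.1 hH ε hε
  -- A nonnegative frequency on the circle is a power of `ζ / r`, a negative one the conjugate of
  -- such a power.
  have key : ∃ P Q : ℂ → ℂ, Differentiable ℂ P ∧ Differentiable ℂ Q ∧
      ∀ θ, F θ = P (r * AddCircle.toCircle θ) + (starRingEnd ℂ) (Q (r * AddCircle.toCircle θ)) := by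
    have hrc : (r : ℂ) ≠ 0 := by exact_mod_cast hr.ne'
    refine Submodule.span_induction ?_ ?_ ?_ ?_ hF
    · rintro _ ⟨k, rfl⟩
      obtain ⟨m, rfl | rfl⟩ := k.eq_nat_or_neg
      · refine ⟨fun ζ => (ζ / r) ^ m, 0, by fun_prop, by fun_prop, fun θ => ?_⟩
        simp [fourier_apply, mul_div_cancel_left₀ _ hrc, AddCircle.toCircle_nsmul]
      · refine ⟨0, fun ζ => (ζ / r) ^ m, by fun_prop, by fun_prop, fun θ => ?_⟩
        rw [fourier_neg]
        simp [fourier_apply, mul_div_cancel_left₀ _ hrc, AddCircle.toCircle_nsmul]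
    · exact ⟨0, 0, by fun_prop, by fun_prop, fun θ => by simp⟩
    · rintro F G - - ⟨P, Q, hP, hQ, h⟩ ⟨P', Q', hP', hQ', h'⟩
      refine ⟨P + P', Q + Q', hP.add hP', hQ.add hQ', fun θ => ?_⟩
      simp [h, h']
      ring
    · rintro a F - ⟨P, Q, hP, hQ, h⟩
      refine ⟨fun ζ => a * P ζ, fun ζ => (starRingEnd ℂ) a * Q ζ, hP.const_mul _, hQ.const_mul _,
        fun θ => ?_⟩
      simp [h]
      ring
  obtain ⟨P, Q, hP, hQ, hPQ⟩ := key
  -- Conjugation does not change the real part, so `P + Q` has the same real part as `P + conj Q`.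
  refine ⟨fun ζ => P ζ + Q ζ, hP.add hQ, fun ζ hζ => ?_⟩
  have hrc : (r : ℂ) ≠ 0 := by exact_mod_cast hr.ne'
  obtain ⟨θ, hθ⟩ := (AddCircle.homeomorphCircle (T := (1 : ℝ)) one_ne_zero).surjective
    ⟨ζ / r, by simp [Submonoid.unitSphere, hζ, abs_of_pos hr, hr.ne']⟩
  have hθ' : (r : ℂ) * AddCircle.toCircle θ = ζ := by
    rw [← AddCircle.homeomorphCircle_apply (T := (1 : ℝ)) one_ne_zero, hθ]
    simp [mul_div_cancel₀ _ hrc]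
  have h1 : ‖H θ - F θ‖ < ε :=
    lt_of_le_of_lt ((H - F).norm_coe_le_norm θ) (by rwa [← dist_eq_norm])
  have h2 := (Complex.abs_re_le_norm (H θ - F θ)).trans_lt h1
  rw [hPQ, hθ'] at h2
  have h3 : H θ = (h ζ : ℂ) := by
    rw [← hθ']
    rfl
  rw [h3, ← abs_neg] at h2
  simpa using h2

lemma contDiff_two_re_of_entire {P : ℂ → ℂ} (hP : Differentiable ℂ P) :
    ContDiff ℝ 2 fun ζ => (P ζ).re :=
  Complex.reCLM.contDiff.comp (hP.contDiff.restrict_scalars ℝ)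

lemma fderiv_fderiv_re_of_entire {P : ℂ → ℂ} (hP : Differentiable ℂ P) (ζ : ℂ) :
    fderiv ℝ (fderiv ℝ fun ζ => (P ζ).re) ζ 1 1 +
      fderiv ℝ (fderiv ℝ fun ζ => (P ζ).re) ζ Complex.I Complex.I = 0 := by
  have h := (AnalyticAt.harmonicAt_re (hP.analyticAt ζ)).2.self_of_nhds
  rw [InnerProductSpace.laplacian_eq_iteratedFDeriv_complexPlane] at h
  simpa [iteratedFDeriv_two_apply] using h

lemma circleAverage_re_of_entire {P : ℂ → ℂ} (hP : Differentiable ℂ P) (r : ℝ) :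
    Real.circleAverage (fun ζ => (P ζ).re) 0 r = (P 0).re :=
  InnerProductSpace.HarmonicOnNhd.circleAverage_eq
    fun ζ _ => AnalyticAt.harmonicAt_re (hP.analyticAt ζ)

/-- If the inequality failed, a harmonic majorant of `w` on the circle, corrected by `c' |ζ|²` with
`c' < c` and steepened across the complex line, would yield an upper test function whose Levi form
in direction `ξ` is only `c'`. -/
lemma le_circleAverage_of_leviGe {w : Cn n → ℝ} {k : NNReal} (hw : LipschitzWith k w) {c : ℝ}
    {z ξ : Cn n} (hξ : ‖ξ‖ = 1) {r R : ℝ} (hr : 0 < r) (hrR : r < R)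
    (h : ∀ x ∈ Metric.ball z R, LeviGe w x c) :
    w z + c * r ^ 2 ≤ Real.circleAverage (fun ζ => w (z + ζ • ξ)) 0 r := by
  by_contra! hcon
  set avg := Real.circleAverage (fun ζ => w (z + ζ • ξ)) 0 r with havg
  -- Of the four `ε`, one pays for replacing the mean by `Re P 0`, one for `c'` in place of `c`, and
  -- two for the lift in `ψ`.
  obtain ⟨ε, hε, hεd⟩ : ∃ ε : ℝ, 0 < ε ∧ avg + 4 * ε < w z + c * r ^ 2 :=
    ⟨(w z + c * r ^ 2 - avg) / 8, by linarith, by linarith⟩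
  have hwc : Continuous fun ζ : ℂ => w (z + ζ • ξ) := hw.continuous.comp (by fun_prop)
  obtain ⟨P, hP, hPw⟩ := exists_entire_re_approx hwc hr hε
  have hPre := contDiff_two_re_of_entire hP
  have hP0 : (P 0).re ≤ avg + ε := by
    have h1 : (P 0).re = Real.circleAverage (fun ζ => (P ζ).re) 0 r :=
      (circleAverage_re_of_entire hP r).symm
    have h2 : avg + ε = Real.circleAverage (fun ζ => w (z + ζ • ξ) + ε) 0 r := by
      rw [Real.circleAverage_fun_add hwc.continuousOn.circleIntegrable'
        continuousOn_const.circleIntegrable', Real.circleAverage_const]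
    rw [h1, h2]
    refine Real.circleAverage_mono hPre.continuous.continuousOn.circleIntegrable'
      (hwc.add continuous_const).continuousOn.circleIntegrable' fun ζ hζ => ?_
    have := (abs_lt.1 (hPw ζ (by simpa [abs_of_pos hr] using hζ))).2
    linarith
  obtain ⟨c', hc', hcc'⟩ : ∃ c' : ℝ, c' * r ^ 2 = c * r ^ 2 - ε ∧ c' < c :=
    ⟨c - ε / r ^ 2, by field_simp, by linarith [div_pos hε (pow_pos hr 2)]⟩
  obtain ⟨ρ, hρ, hρR, hkρ⟩ : ∃ ρ : ℝ, 0 < ρ ∧ r + ρ < R ∧ k * ρ < ε := by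
    have hk : (0 : ℝ) ≤ k := k.2
    refine ⟨min ((R - r) / 2) (ε / (k + 1)), lt_min (by linarith) (by positivity), ?_, ?_⟩
    · linarith [min_le_left ((R - r) / 2) (ε / (k + 1))]
    · calc (k : ℝ) * min ((R - r) / 2) (ε / (k + 1)) ≤ k * (ε / (k + 1)) := by
            gcongr; exact min_le_right _ _
        _ < ε := by
            rw [mul_div_assoc', div_lt_iff₀ (by positivity)]
            nlinarith
  -- `ℓ` is the coordinate along `ξ` and `Q` the complementary projection; `S` below is a thin
  -- cylinder around the disc.
  let ℓ : Cn n →L[ℂ] ℂ := innerSL ℂ ξ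
  let Q : Cn n →L[ℂ] Cn n := ContinuousLinearMap.id ℂ (Cn n) - ℓ.smulRight ξ
  have hℓξ : ℓ ξ = 1 := by
    simp [ℓ, inner_self_eq_norm_sq_to_K, hξ]
  have hQξ : Q ξ = 0 := by simp [Q, hℓξ]
  have hdec : ∀ x, x = z + (ℓ x + -ℓ z) • ξ + (Q x + -Q z) := fun x => by
    simp [Q, add_smul]
    abel
  have hℓc : Continuous fun x => ‖ℓ x + -ℓ z‖ := by fun_prop
  have hQc : Continuous fun x => ‖Q x + -Q z‖ := by fun_prop
  let S : Set (Cn n) := {x | ‖ℓ x + -ℓ z‖ ≤ r} ∩ {x | ‖Q x + -Q z‖ ≤ ρ}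
  have hSball : S ⊆ Metric.closedBall z (r + ρ) := by
    rintro x ⟨hx1, hx2⟩
    have hx1' : ‖ℓ x + -ℓ z‖ ≤ r := hx1
    have hx2' : ‖Q x + -Q z‖ ≤ ρ := hx2
    rw [mem_closedBall_iff_norm]
    have : x - z = (ℓ x + -ℓ z) • ξ + (Q x + -Q z) := by
      conv_lhs => rw [hdec x]
      abel
    rw [this]
    refine (norm_add_le _ _).trans (add_le_add ?_ hx2')
    rwa [norm_smul, hξ, mul_one]
  have hScpt : IsCompact S :=
    (isCompact_closedBall z (r + ρ)).of_isClosed_subset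
      ((isClosed_le hℓc continuous_const).inter (isClosed_le hQc continuous_const)) hSball
  have hzS : z ∈ S := by
    constructor <;> simp [hr.le, hρ.le]
  let χ : Cn n → ℝ := fun x => (P (ℓ x + -ℓ z)).re + c' * ‖ℓ x + -ℓ z‖ ^ 2
  have hP2 : ContDiff ℝ 2 fun x : Cn n => (P (ℓ x + -ℓ z)).re :=
    hPre.comp ((ℓ.restrictScalars ℝ).contDiff.add contDiff_const)
  have hℓ2 : ContDiff ℝ 2 fun x : Cn n => ‖ℓ x + -ℓ z‖ ^ 2 :=
    ((contDiff_norm_sq ℝ).comp ((ℓ.restrictScalars ℝ).contDiff.add contDiff_const))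
  have hQ2 : ContDiff ℝ 2 fun x : Cn n => ‖Q x + -Q z‖ ^ 2 := by
    let _ := InnerProductSpace.complexToReal (G := Cn n)
    exact ((contDiff_norm_sq ℝ).comp ((Q.restrictScalars ℝ).contDiff.add contDiff_const))
  have hχ2 : ContDiff ℝ 2 χ := hP2.add (contDiff_const.mul hℓ2)
  obtain ⟨M, hM⟩ := hScpt.bddAbove_image (f := fun x => w x - χ x - 2 * ε + c' * r ^ 2)
    (by have := hw.continuous; have := hχ2.continuous; fun_prop)
  obtain ⟨A, hA0, hAM⟩ : ∃ A : ℝ, 0 ≤ A ∧ M < A * ρ ^ 2 := by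
    refine ⟨(|M| + 1) / ρ ^ 2, by positivity, ?_⟩
    rw [div_mul_cancel₀ _ (by positivity)]
    linarith [le_abs_self M]
  -- The constant puts `ψ` above `w` on the side `‖ℓ‖ = r` of the cylinder: one `ε` is the error of
  -- `P`, the other absorbs `k ρ`, the change of `w` away from the disc. A large `A` does the same
  -- where `‖Q‖ = ρ`. At `z`, however, `ψ < w`, so the maximum of `w - ψ` is interior.
  let ψ : Cn n → ℝ := fun x => χ x + A * ‖Q x + -Q z‖ ^ 2 + (2 * ε - c' * r ^ 2)
  have hψ2 : ContDiff ℝ 2 ψ := (hχ2.add (contDiff_const.mul hQ2)).add contDiff_const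
  obtain ⟨x₀, hx₀S, hx₀⟩ := hScpt.exists_isMaxOn ⟨z, hzS⟩ (f := fun x => w x - ψ x)
    (hw.continuous.sub hψ2.continuous).continuousOn
  have hpos : 0 < w x₀ - ψ x₀ := by
    refine lt_of_lt_of_le ?_ (hx₀ hzS)
    simp only [ψ, χ, add_neg_cancel, norm_zero]
    linarith
  have hx₀Q : ‖Q x₀ + -Q z‖ < ρ := by
    refine lt_of_le_of_ne hx₀S.2 fun heq => ?_
    have h1 := hM (Set.mem_image_of_mem _ hx₀S)
    simp only [ψ, heq] at hpos h1
    linarith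
  have hx₀ℓ : ‖ℓ x₀ + -ℓ z‖ < r := by
    refine lt_of_le_of_ne hx₀S.1 fun heq => ?_
    have h1 := (abs_lt.1 (hPw _ heq)).1
    have h2 : w x₀ ≤ w (z + (ℓ x₀ + -ℓ z) • ξ) + k * ρ := by
      have h3 := hw.dist_le_mul x₀ (z + (ℓ x₀ + -ℓ z) • ξ)
      rw [Real.dist_eq, dist_eq_norm] at h3
      have h4 : x₀ - (z + (ℓ x₀ + -ℓ z) • ξ) = Q x₀ + -Q z := by
        nth_rewrite 1 [hdec x₀]
        abel
      rw [h4] at h3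
      have h5 : (k : ℝ) * ‖Q x₀ + -Q z‖ ≤ k * ρ := by gcongr
      linarith [le_abs_self (w x₀ - w (z + (ℓ x₀ + -ℓ z) • ξ))]
    have h6 : 0 ≤ A * ‖Q x₀ + -Q z‖ ^ 2 := by positivity
    simp only [ψ, χ, heq] at hpos
    linarith
  have hSnhds : ∀ᶠ y in 𝓝 x₀, y ∈ S := by
    filter_upwards [hℓc.continuousAt.eventually_lt continuousAt_const hx₀ℓ,
      hQc.continuousAt.eventually_lt continuousAt_const hx₀Q] with y h1 h2
    exact ⟨h1.le, h2.le⟩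
  have hlevi := h x₀ (Metric.closedBall_subset_ball hρR (hSball hx₀S))
    (fun x => ψ x + (w x₀ - ψ x₀)) (hψ2.add contDiff_const).contDiffAt (by simp)
    (hSnhds.mono fun y hy => by
      have : w y - ψ y ≤ w x₀ - ψ x₀ := hx₀ hy
      linarith) ξ
  -- In direction `ξ` the term in `Q` vanishes and `Re P` is harmonic, so only `c'` remains.
  rw [levi_add_const, levi_add_const, levi_add hχ2.contDiffAt (contDiff_const.mul hQ2).contDiffAt,
    levi_const_mul A hQ2.contDiffAt, levi_norm_affine_sq, hQξ,
    levi_add hP2.contDiffAt (contDiff_const.mul hℓ2).contDiffAt,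
    levi_const_mul c' hℓ2.contDiffAt, levi_norm_affine_sq,
    levi_comp_affine ℓ (-ℓ z) (G := fun ζ => (P ζ).re) hPre.contDiffAt, hℓξ, smul_eq_mul, mul_one,
    fderiv_fderiv_re_of_entire hP, hξ] at hlevi
  simp at hlevi
  linarith

/-! ### Taylor expansion and mollification -/

/-- The remainder has derivative `o(‖x‖)` because the first derivative is differentiable at `z`; the
mean value inequality on a ball integrates this bound. -/
lemma eventually_abs_sub_taylor_two_le {E : Type*} [NormedAddCommGroup E] [NormedSpace ℝ E]
    {G : E → ℝ} {z : E} (hG : ContDiffAt ℝ 2 G z) {ε : ℝ} (hε : 0 < ε) :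
    ∀ᶠ h in 𝓝 (0 : E), |G (z + h) - G z - fderiv ℝ G z h -
      fderiv ℝ (fderiv ℝ G) z h h / 2| ≤ ε * ‖h‖ ^ 2 := by
  set B := fderiv ℝ (fderiv ℝ G) z with hB
  have hsymm : ∀ a b, B a b = B b a := hG.isSymmSndFDerivAt (by simp)
  have hlo := hasFDerivAt_iff_isLittleO_nhds_zero.1
    (differentiableAt_fderiv_of_contDiffAt_two hG).hasFDerivAt
  have hev : ∀ᶠ h in 𝓝 (0 : E), DifferentiableAt ℝ G (z + h) := by
    have : Tendsto (fun h : E => z + h) (𝓝 0) (𝓝 z) := by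
      have h : Continuous fun h : E => z + h := by fun_prop
      simpa using h.tendsto 0
    exact this.eventually (eventually_differentiableAt_of_contDiffAt_two hG)
  obtain ⟨δ, hδ, hball⟩ := Metric.eventually_nhds_iff_ball.1 (hev.and (hlo.def hε))
  filter_upwards [Metric.ball_mem_nhds (0 : E) hδ] with h hh
  let R : E → ℝ := fun x => G (z + x) - G z - fderiv ℝ G z x - B x x / 2
  have hsub : Metric.closedBall (0 : E) ‖h‖ ⊆ Metric.ball 0 δ :=
    Metric.closedBall_subset_ball (by simpa using hh)
  have hR : ∀ x ∈ Metric.closedBall (0 : E) ‖h‖,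
      HasFDerivAt R (fderiv ℝ G (z + x) - fderiv ℝ G z - B x) x := by
    intro x hx
    have h1 : HasFDerivAt (fun x => G (z + x)) (fderiv ℝ G (z + x)) x :=
      (hball x (hsub hx)).1.hasFDerivAt.comp x ((hasFDerivAt_id x).const_add z)
    have h2 : HasFDerivAt (fun x => B x x / 2) (B x) x := by
      have h3 := ((B.hasFDerivAt (x := x)).clm_apply (hasFDerivAt_id x)).mul_const (2⁻¹ : ℝ)
      refine (h3.congr_fderiv ?_)
      ext v
      simp [hsymm v x]
      ring
    exact ((h1.sub_const (G z)).sub (fderiv ℝ G z).hasFDerivAt).sub h2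
  have hbound := (convex_closedBall (0 : E) ‖h‖).norm_image_sub_le_of_norm_hasFDerivWithin_le
    (C := ε * ‖h‖) (fun x hx => (hR x hx).hasFDerivWithinAt)
    (fun x hx => (hball x (hsub hx)).2.trans (by
      gcongr
      simpa using hx))
    (by simp : (0 : E) ∈ Metric.closedBall (0 : E) ‖h‖) (by simp : h ∈ Metric.closedBall (0 : E) ‖h‖)
  simp only [R, Real.norm_eq_abs, add_zero, map_zero, sub_self, sub_zero, zero_div] at hbound
  calc _ ≤ ε * ‖h‖ * ‖h‖ := hbound
    _ = _ := by ring

lemma le_levi_of_le_circleAverage {g : Cn n → ℝ} (hg : ContDiff ℝ 2 g) {z ξ : Cn n}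
    (hξ : ‖ξ‖ = 1) {c : ℝ}
    (h : ∀ᶠ r in 𝓝[>] (0 : ℝ),
      g z + c * r ^ 2 ≤ Real.circleAverage (fun ζ => g (z + ζ • ξ)) 0 r) :
    c ≤ levi g z ξ := by
  refine le_of_forall_pos_le_add fun ε hε => ?_
  have hgc : Continuous fun ζ : ℂ => g (z + ζ • ξ) := hg.continuous.comp (by fun_prop)
  have hT : ∀ᶠ r in 𝓝[>] (0 : ℝ), ∀ ζ : ℂ, ‖ζ‖ = r → |g (z + ζ • ξ) - g z - fderiv ℝ g z (ζ • ξ) -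
      fderiv ℝ (fderiv ℝ g) z (ζ • ξ) (ζ • ξ) / 2| ≤ ε * r ^ 2 := by
    obtain ⟨δ, hδ, hball⟩ := Metric.eventually_nhds_iff_ball.1
      (eventually_abs_sub_taylor_two_le hg.contDiffAt (z := z) hε)
    filter_upwards [Ioo_mem_nhdsGT hδ] with r hr ζ hζ
    have h1 : ‖ζ • ξ‖ = r := by rw [norm_smul, hξ, mul_one, hζ]
    have h2 := hball (ζ • ξ) (by simpa [h1] using hr.2)
    rwa [h1] at h2
  obtain ⟨r, hr1, hr2, hr0⟩ := (h.and (hT.and self_mem_nhdsWithin)).exists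
  have hr0 : 0 < r := hr0
  set B := fderiv ℝ (fderiv ℝ g) z with hB
  have hsymm : ∀ a b, B a b = B b a := hg.contDiffAt.isSymmSndFDerivAt (by simp)
  have hsplit : ∀ ζ : ℂ, ζ • ξ = ζ.re • ξ + ζ.im • (Complex.I • ξ) := fun ζ => by
    conv_lhs => rw [← Complex.re_add_im ζ]
    rw [add_smul, mul_smul]
    rfl
  -- On a complex line the quadratic Taylor term is the Levi form times `|ζ|²` plus `Re (β ζ²)`.
  -- With `|ζ| = r` the whole polynomial is the real part of the entire `P`, whose mean is its value
  -- at `0`.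
  let α : ℂ := ⟨fderiv ℝ g z ξ, -fderiv ℝ g z (Complex.I • ξ)⟩
  let β : ℂ := ⟨(B ξ ξ - B (Complex.I • ξ) (Complex.I • ξ)) / 4, -B ξ (Complex.I • ξ) / 2⟩
  let P : ℂ → ℂ := fun ζ => (g z + (levi g z ξ + ε) * r ^ 2 : ℝ) + α * ζ + β * ζ ^ 2
  have hP : Differentiable ℂ P := by fun_prop
  have hle : Real.circleAverage (fun ζ => g (z + ζ • ξ)) 0 r ≤ (P 0).re := by
    rw [← circleAverage_re_of_entire hP r]
    refine Real.circleAverage_mono hgc.continuousOn.circleIntegrable'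
      (contDiff_two_re_of_entire hP).continuous.continuousOn.circleIntegrable' fun ζ hζ => ?_
    have hζr : ‖ζ‖ = r := by simpa [abs_of_pos hr0] using hζ
    have h1 := (abs_le.1 (hr2 ζ hζr)).2
    have h2 : r ^ 2 = ζ.re ^ 2 + ζ.im ^ 2 := by
      rw [← hζr, Complex.sq_norm, Complex.normSq_apply]; ring
    rw [hsplit ζ] at h1 ⊢
    simp only [map_add, map_smul, add_apply, smul_apply, smul_eq_mul,
      hsymm (Complex.I • ξ) ξ] at h1
    simp only [P, α, β, levi, secondDeriv, Complex.add_re, Complex.ofReal_re, Complex.mul_re,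
      pow_two, Complex.mul_im, ← hB]
    simp only [pow_two] at h2 h1
    rw [h2] at h1 ⊢
    linarith
  have hP0 : (P 0).re = g z + (levi g z ξ + ε) * r ^ 2 := by
    simp only [P, mul_zero, add_zero, ne_eq, OfNat.ofNat_ne_zero, not_false_eq_true, zero_pow,
      Complex.ofReal_re]
  have : c * r ^ 2 ≤ (levi g z ξ + ε) * r ^ 2 := by linarith
  exact le_of_mul_le_mul_right this (by positivity)

/-- Averaging a function over translations by a smooth bump of integral one. -/
def mollify (ρ : ContDiffBump (0 : Cn n)) (w : Cn n → ℝ) : Cn n → ℝ :=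
  convolution (ρ.normed (Measure.addHaar (G := Cn n))) w (ContinuousLinearMap.lsmul ℝ ℝ)
    Measure.addHaar

lemma contDiff_mollify (ρ : ContDiffBump (0 : Cn n)) {w : Cn n → ℝ} (hw : Continuous w) :
    ContDiff ℝ 2 (mollify ρ w) := by
  have := ρ.hasCompactSupport_normed (μ := Measure.addHaar (G := Cn n))
    |>.contDiff_convolution_left (n := 2) (ContinuousLinearMap.lsmul ℝ ℝ)
    ρ.contDiff_normed (hw.locallyIntegrable (μ := Measure.addHaar))
  exact this

lemma abs_mollify_sub_le (ρ : ContDiffBump (0 : Cn n)) {w : Cn n → ℝ} {k : NNReal}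
    (hw : LipschitzWith k w) (z : Cn n) : |mollify ρ w z - w z| ≤ k * ρ.rOut := by
  have := ρ.dist_normed_convolution_le (μ := Measure.addHaar (G := Cn n)) (g := w) (x₀ := z)
    (ε := k * ρ.rOut) hw.continuous.aestronglyMeasurable (fun x hx => by
      refine (hw.dist_le_mul x z).trans ?_
      have := (Metric.mem_ball.1 hx).le
      gcongr)
  rwa [Real.dist_eq] at this

/-- Translates of `w` satisfy the same inequality; integrating them against the bump and exchanging
the integrals preserves it. -/
lemma mollify_le_circleAverage (ρ : ContDiffBump (0 : Cn n)) {w : Cn n → ℝ} (hw : Continuous w)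
    {z ξ : Cn n} {c r : ℝ}
    (h : ∀ x ∈ Metric.ball z ρ.rOut,
      w x + c * r ^ 2 ≤ Real.circleAverage (fun ζ => w (x + ζ • ξ)) 0 r) :
    mollify ρ w z + c * r ^ 2 ≤ Real.circleAverage (fun ζ => mollify ρ w (z + ζ • ξ)) 0 r := by
  set a := ρ.normed (Measure.addHaar (G := Cn n)) with ha
  have hac : Continuous a := ρ.continuous_normed
  have hacs : HasCompactSupport a := ρ.hasCompactSupport_normed
  have hmol : ∀ x, mollify ρ w x = ∫ t, a t * w (x - t) ∂Measure.addHaar := fun x => rfl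
  have hswap : Real.circleAverage (fun ζ => mollify ρ w (z + ζ • ξ)) 0 r =
      ∫ t, a t * Real.circleAverage (fun ζ => w (z - t + ζ • ξ)) 0 r ∂Measure.addHaar := by
    have hint : Integrable (Function.uncurry fun (θ : ℝ) (t : Cn n) =>
        a t * w (z + circleMap 0 r θ • ξ - t))
        ((volume.restrict (Set.Ioc 0 (2 * Real.pi))).prod Measure.addHaar) := by
      have hc : Continuous (Function.uncurry fun (θ : ℝ) (t : Cn n) =>
          a t * w (z + circleMap 0 r θ • ξ - t)) := by
        unfold Function.uncurry
        have : Continuous (circleMap 0 r) := by fun_prop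
        fun_prop
      rw [← integrableOn_iff_integrable_of_support_subset
        (s := (Set.univ : Set ℝ) ×ˢ tsupport a), IntegrableOn, ← Measure.prod_restrict,
        Measure.restrict_univ, Measure.prod_restrict]
      · exact (hc.continuousOn.integrableOn_compact (isCompact_Icc.prod hacs)).mono_set
          (Set.prod_mono Set.Ioc_subset_Icc_self subset_rfl)
      · rintro ⟨θ, t⟩ h
        exact ⟨trivial, subset_tsupport a (left_ne_zero_of_mul h)⟩
    simp only [Real.circleAverage, hmol]
    rw [intervalIntegral.integral_of_le Real.two_pi_pos.le, integral_integral_swap hint,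
      ← integral_smul]
    refine integral_congr_ae (.of_forall fun t => ?_)
    simp only [smul_eq_mul]
    rw [integral_const_mul, intervalIntegral.integral_of_le Real.two_pi_pos.le]
    simp only [add_sub_right_comm]
    ring
  have hone : ∫ t, a t ∂Measure.addHaar = 1 := ρ.integral_normed
  have hwz : Continuous fun t => w (z - t) := hw.comp (by fun_prop)
  have hi : Integrable (fun t => a t * w (z - t)) (Measure.addHaar (G := Cn n)) :=
    (hac.mul hwz).integrable_of_hasCompactSupport hacs.mul_right
  have hi' : Integrable a (Measure.addHaar (G := Cn n)) := hac.integrable_of_hasCompactSupport hacs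
  have havg : Continuous fun t : Cn n => Real.circleAverage (fun ζ => w (z - t + ζ • ξ)) 0 r := by
    unfold Real.circleAverage
    have h : Continuous fun t : Cn n =>
        ∫ θ in (0 : ℝ)..(2 * Real.pi), w (z - t + circleMap 0 r θ • ξ) := by
      refine intervalIntegral.continuous_parametric_intervalIntegral_of_continuous' ?_ _ _
      unfold Function.uncurry
      have : Continuous (circleMap 0 r) := by fun_prop
      fun_prop
    exact h.const_smul ((2 * Real.pi)⁻¹ : ℝ)
  rw [hswap]
  calc mollify ρ w z + c * r ^ 2
      = ∫ t, (a t * w (z - t) + a t * (c * r ^ 2)) ∂Measure.addHaar := by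
        rw [integral_add hi (hi'.mul_const _), integral_mul_const, hone, one_mul, hmol]
    _ ≤ _ := by
        refine integral_mono (hi.add (hi'.mul_const _))
          ((hac.mul havg).integrable_of_hasCompactSupport hacs.mul_right) fun t => ?_
        by_cases ht : t ∈ Metric.ball (0 : Cn n) ρ.rOut
        · have h1 := h (z - t) (by simpa using ht)
          have h2 : 0 ≤ a t := ρ.nonneg_normed t
          have := mul_le_mul_of_nonneg_left h1 h2
          simpa [mul_add] using this
        · have : a t = 0 := by
            rw [← Function.notMem_support, ha, ρ.support_normed_eq]
            exact ht
          simp [this]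

/-! ### Lipschitz regularization and smooth approximation of subsolutions -/

lemma LeviGe.mono {w : Cn n → ℝ} {x : Cn n} {c c' : ℝ} (h : LeviGe w x c) (hc : c' ≤ c) :
    LeviGe w x c' := fun ψ h1 h2 h3 ξ =>
  (mul_le_mul_of_nonneg_right hc (sq_nonneg _)).trans (h ψ h1 h2 h3 ξ)

lemma levi_real_smul (ψ : Cn n → ℝ) (z ξ : Cn n) (a : ℝ) :
    levi ψ z (a • ξ) = a ^ 2 * levi ψ z ξ := by
  simp only [levi, secondDeriv, smul_comm Complex.I a, map_smul, smul_apply, smul_eq_mul]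
  ring

lemma forall_le_levi_of_unit {ψ : Cn n → ℝ} {z : Cn n} {c : ℝ}
    (h : ∀ ξ : Cn n, ‖ξ‖ = 1 → c ≤ levi ψ z ξ) (ξ : Cn n) : c * ‖ξ‖ ^ 2 ≤ levi ψ z ξ := by
  rcases eq_or_ne ξ 0 with rfl | hξ
  · simp [levi, secondDeriv]
  · have h0 : ‖ξ‖ ≠ 0 := norm_ne_zero_iff.2 hξ
    have h1 := h (‖ξ‖⁻¹ • ξ) (by rw [norm_smul, norm_inv, norm_norm, inv_mul_cancel₀ h0])
    rw [levi_real_smul, inv_pow, inv_mul_eq_div, le_div_iff₀ (by positivity)] at h1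
    exact h1

/-- The Lipschitz regularization `sup_{y ∈ Ω} (u(y) - k |z - y|)`. -/
def supConv (Ω : Set (Cn n)) (u : Cn n → ℝ) (k : NNReal) (z : Cn n) : ℝ :=
  ⨆ y : Ω, (u y - k * ‖z - y‖)

section SupConv

variable {Ω : Set (Cn n)} {u : Cn n → ℝ} {k : NNReal} {M : ℝ}

lemma le_supConv (hM : ∀ z ∈ Ω, |u z| ≤ M) {y : Cn n} (hy : y ∈ Ω) (z : Cn n) :
    u y - k * ‖z - y‖ ≤ supConv Ω u k z := by
  refine le_ciSup (f := fun y : Ω => u y - k * ‖z - y‖) ⟨M, ?_⟩ ⟨y, hy⟩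
  rintro _ ⟨x, rfl⟩
  have h1 := (abs_le.1 (hM x x.2)).2
  have h2 : 0 ≤ k * ‖z - x‖ := by positivity
  simp only
  linarith

lemma lipschitzWith_supConv (hΩ : Ω.Nonempty) (hM : ∀ z ∈ Ω, |u z| ≤ M) :
    LipschitzWith k (supConv Ω u k) := by
  have : Nonempty Ω := hΩ.to_subtype
  refine LipschitzWith.of_le_add_mul k fun x y => ciSup_le fun a => ?_
  have h1 := le_supConv (k := k) hM a.2 y
  have h2 : (k : ℝ) * ‖y - a‖ ≤ k * ‖x - a‖ + k * dist x y := by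
    rw [← mul_add, add_comm, dist_comm, ← dist_eq_norm, ← dist_eq_norm]
    exact mul_le_mul_of_nonneg_left (dist_triangle _ _ _) k.2
  linarith

/-- Beyond distance `t` the penalty exceeds the oscillation `2 M` of `u`, so distant points do no
better than `z` itself. -/
lemma exists_supConv_eq (hu : UpperSemicontinuousOn u Ω) (hM : ∀ z ∈ Ω, |u z| ≤ M)
    {z : Cn n} {t : ℝ} (ht : 0 < t) (hzt : Metric.closedBall z t ⊆ Ω) (hkt : 2 * M < k * t) :
    ∃ y ∈ Metric.closedBall z t, supConv Ω u k z = u y - k * ‖z - y‖ := by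
  have hz : z ∈ Metric.closedBall z t := Metric.mem_closedBall_self ht.le
  have : Nonempty Ω := ⟨⟨z, hzt hz⟩⟩
  obtain ⟨y, hy, hmax⟩ := UpperSemicontinuousOn.exists_isMaxOn
    (f := fun y => u y + -(k * ‖z - y‖)) ⟨z, hz⟩ (isCompact_closedBall z t)
    ((hu.mono hzt).add (Continuous.continuousOn (by fun_prop)).upperSemicontinuousOn)
  refine ⟨y, hy, le_antisymm (ciSup_le fun x => ?_) (le_supConv hM (hzt hy) z)⟩
  by_cases hx : (x : Cn n) ∈ Metric.closedBall z t
  · have : u x + -(k * ‖z - x‖) ≤ u y + -(k * ‖z - y‖) := hmax hx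
    linarith
  · have h1 : u z + -(k * ‖z - z‖) ≤ u y + -(k * ‖z - y‖) := hmax hz
    have h2 : k * t ≤ k * ‖z - x‖ := by
      refine mul_le_mul_of_nonneg_left ?_ k.2
      rw [Metric.mem_closedBall, not_le, dist_comm, dist_eq_norm] at hx
      exact hx.le
    have h3 := (abs_le.1 (hM x x.2)).2
    have h4 := (abs_le.1 (hM z (hzt hz))).1
    simp only [sub_self, norm_zero, mul_zero, neg_zero, add_zero] at h1
    linarith

/-- If `y` realizes the supremum at `z`, translating a test function at `z` by `z - y` and adding
the penalty gives a test function for `u` at `y`. -/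
lemma leviGe_supConv (hΩ : IsOpen Ω) (hu : UpperSemicontinuousOn u Ω) (hM : ∀ z ∈ Ω, |u z| ≤ M)
    {z : Cn n} {t : ℝ} (ht : 0 < t) (hzt : Metric.closedBall z t ⊆ Ω) (hkt : 2 * M < k * t)
    {c : ℝ} (hc : ∀ y ∈ Metric.closedBall z t, LeviGe u y c) : LeviGe (supConv Ω u k) z c := by
  intro ψ hψ hψz hle ξ
  obtain ⟨y, hy, hzy⟩ := exists_supConv_eq hu hM ht hzt hkt
  have hyz : y + (z - y) = z := by abel
  have htend : Tendsto (fun x => x + (z - y)) (𝓝 y) (𝓝 z) := by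
    have h : Continuous fun x : Cn n => x + (z - y) := by fun_prop
    simpa [hyz] using h.tendsto y
  have h := hc y hy (fun x => ψ (x + (z - y)) + k * ‖z - y‖)
    ((ContDiffAt.comp y (hyz.symm ▸ hψ) (by fun_prop)).add contDiffAt_const)
    (by simp only [hyz, hψz, hzy]; ring) (by
      filter_upwards [htend.eventually hle, hΩ.mem_nhds (hzt hy)] with x hx hxΩ
      have h1 := le_supConv (k := k) hM hxΩ (x + (z - y))
      rw [add_sub_cancel_left] at h1
      linarith) ξ
  rwa [levi_add_const, levi_comp_add, hyz] at h

end SupConv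

/-- The upper bound for `g` uses the value of `u` at a nearby point because `u` is only upper
semicontinuous. -/
lemma exists_smooth_approx {Ω : Set (Cn n)} (hΩ : IsOpen Ω) (hne : Ω.Nonempty) {u f : Cn n → ℝ}
    (hu : UpperSemicontinuousOn u Ω) {M : ℝ} (hM : ∀ z ∈ Ω, |u z| ≤ M)
    (hf : UniformContinuousOn f Ω) (hsub : ∀ z ∈ Ω, LeviGe u z (f z))
    {K : Set (Cn n)} (hK : IsCompact K) (hKΩ : K ⊆ Ω) {ε : ℝ} (hε : 0 < ε) :
    ∃ g : Cn n → ℝ, ContDiff ℝ 2 g ∧ ∀ z ∈ K,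
      (∀ ξ, (f z - ε) * ‖ξ‖ ^ 2 ≤ levi g z ξ) ∧ u z - ε ≤ g z ∧
        ∃ y ∈ Ω, dist y z < ε ∧ g z ≤ u y + ε := by
  obtain ⟨δ, hδ, hδΩ⟩ := hK.exists_cthickening_subset_open hΩ hKΩ
  obtain ⟨s, hs, hsf⟩ := Metric.uniformContinuousOn_iff.1 hf ε hε
  -- Mollification, circles and sup-convolution each move a point by at most `t`; the total stays
  -- below `4 t`, within reach of `Ω` and of the uniform continuity of `f`.
  obtain ⟨t, ht, htδ, hts, htε⟩ : ∃ t : ℝ, 0 < t ∧ 4 * t ≤ δ ∧ 4 * t ≤ s ∧ 4 * t ≤ ε :=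
    ⟨min δ (min s ε) / 4, by positivity, by linarith [min_le_left δ (min s ε)],
      by linarith [min_le_right δ (min s ε), min_le_left s ε],
      by linarith [min_le_right δ (min s ε), min_le_right s ε]⟩
  let k : NNReal := ⟨(2 * |M| + 1) / t, by positivity⟩
  have hkt : 2 * M < k * t := by
    change 2 * M < (2 * |M| + 1) / t * t
    rw [div_mul_cancel₀ _ ht.ne']
    linarith [le_abs_self M]
  have hball : ∀ z ∈ K, ∀ x, dist x z < 4 * t → x ∈ Ω := fun z hz x hx =>
    hδΩ (Metric.mem_cthickening_of_dist_le x z δ K hz (by linarith))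
  set w := supConv Ω u k
  have hw : LipschitzWith k w := lipschitzWith_supConv hne hM
  have hk0 : (0 : ℝ) ≤ k := k.2
  let ρ₀ : ℝ := min t (ε / (k + 1))
  have hρ₀ : 0 < ρ₀ := lt_min ht (by positivity)
  let ρ : ContDiffBump (0 : Cn n) := ⟨ρ₀ / 2, ρ₀, by positivity, by linarith⟩
  have hkρ : k * ρ.rOut ≤ ε := by
    calc (k : ℝ) * ρ₀ ≤ k * (ε / (k + 1)) := by gcongr; exact min_le_right _ _
      _ ≤ ε := by
        rw [mul_div_assoc', div_le_iff₀ (by positivity)]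
        nlinarith
  have hρt : ρ.rOut ≤ t := min_le_left _ _
  have hLw : ∀ z ∈ K, ∀ x, dist x z < 2 * t → LeviGe w x (f z - ε) := by
    intro z hz x hx
    have hsub' : Metric.closedBall x t ⊆ Ω := fun y hy =>
      hball z hz y (by linarith [dist_triangle y x z, Metric.mem_closedBall.1 hy])
    refine leviGe_supConv hΩ hu hM ht hsub' hkt fun y hy => (hsub y (hsub' hy)).mono ?_
    have h1 : dist y z < s := by linarith [dist_triangle y x z, Metric.mem_closedBall.1 hy]
    have h2 := hsf y (hsub' hy) z (hKΩ hz) h1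
    rw [Real.dist_eq] at h2
    linarith [(abs_lt.1 h2).1]
  refine ⟨mollify ρ w, contDiff_mollify ρ hw.continuous, fun z hz => ?_⟩
  have hclose := abs_le.1 (abs_mollify_sub_le ρ hw z)
  refine ⟨forall_le_levi_of_unit fun ξ hξ => ?_, ?_, ?_⟩
  · refine le_levi_of_le_circleAverage (contDiff_mollify ρ hw.continuous) hξ ?_
    filter_upwards [Ioo_mem_nhdsGT ht] with r hr
    refine mollify_le_circleAverage ρ hw.continuous fun x hx =>
      le_circleAverage_of_leviGe hw hξ hr.1 hr.2 fun y hy => hLw z hz y ?_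
    linarith [dist_triangle y x z, Metric.mem_ball.1 hx, Metric.mem_ball.1 hy]
  · have := le_supConv (k := k) hM (hKΩ hz) z
    simp only [sub_self, norm_zero, mul_zero, sub_zero] at this
    linarith
  · have hsub' : Metric.closedBall z t ⊆ Ω := fun y hy =>
      hball z hz y (by linarith [Metric.mem_closedBall.1 hy])
    obtain ⟨y, hy, hzy⟩ := exists_supConv_eq hu hM ht hsub' hkt
    refine ⟨y, hsub' hy, by linarith [Metric.mem_closedBall.1 hy], ?_⟩
    have : 0 ≤ k * ‖z - y‖ := by positivity
    change w z = _ at hzy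
    linarith

/-! ### The comparison principle -/

lemma eventually_lt_of_upperSemicontinuousOn {β : Type*} [Preorder β] {Ω : Set (Cn n)}
    (hΩ : IsOpen Ω) {u : Cn n → β} (hu : UpperSemicontinuousOn u Ω) {z : Cn n} (hz : z ∈ Ω) {a : β}
    (h : u z < a) : ∀ᶠ y in 𝓝 z, u y < a := by
  have := hu z hz a h
  rwa [hΩ.nhdsWithin_eq hz] at this

lemma eventually_lt_of_lowerSemicontinuousOn {β : Type*} [Preorder β] {Ω : Set (Cn n)}
    (hΩ : IsOpen Ω) {u : Cn n → β} (hu : LowerSemicontinuousOn u Ω) {z : Cn n} (hz : z ∈ Ω) {a : β}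
    (h : a < u z) : ∀ᶠ y in 𝓝 z, a < u y := by
  have := hu z hz a h
  rwa [hΩ.nhdsWithin_eq hz] at this

lemma coe_add_le_iff (x : EReal) (a b : ℝ) :
    ((a + b : ℝ) : EReal) ≤ x ↔ (a : EReal) ≤ x + ((-b : ℝ) : EReal) := by
  induction x with
  | bot => simp
  | top => simp
  | coe x =>
    norm_cast
    constructor <;> intro h <;> linarith

lemma le_coe_add_iff (x : EReal) (a b : ℝ) :
    x ≤ ((a + b : ℝ) : EReal) ↔ x + ((-b : ℝ) : EReal) ≤ (a : EReal) := by
  induction x with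
  | bot => simp
  | top => simp only [EReal.top_add_coe, top_le_iff, EReal.coe_ne_top]
  | coe x =>
    norm_cast
    constructor <;> intro h <;> linarith

/-- An extended-real lower semicontinuous function on a compact set is touched from below by a
vertical translate of any continuous function. -/
lemma exists_touching_below {K : Set (Cn n)} (hK : IsCompact K) {v : Cn n → EReal} {g : Cn n → ℝ}
    (hv : LowerSemicontinuousOn v K) (hg : ContinuousOn g K) (hbot : ∀ z ∈ K, v z ≠ ⊥)
    {x : Cn n} (hx : x ∈ K) (hxtop : v x ≠ ⊤) :
    ∃ y ∈ K, ∃ m : ℝ, v y = ((m + g y : ℝ) : EReal) ∧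
      ∀ z ∈ K, ((m + g z : ℝ) : EReal) ≤ v z := by
  have hlsc : LowerSemicontinuousOn (fun z => v z + ((-g z : ℝ) : EReal)) K := by
    refine hv.add' (ContinuousOn.lowerSemicontinuousOn
      (continuous_coe_real_ereal.comp_continuousOn hg.neg)) fun z _ => ?_
    exact EReal.continuousAt_add (.inr (EReal.coe_ne_bot _)) (.inr (EReal.coe_ne_top _))
  obtain ⟨y, hy, hmin⟩ := LowerSemicontinuousOn.exists_isMinOn ⟨x, hx⟩ hK hlsc
  have hytop : v y ≠ ⊤ := by
    intro h
    have h1 : v y + ((-g y : ℝ) : EReal) ≤ v x + ((-g x : ℝ) : EReal) := hmin hx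
    rw [h, EReal.top_add_coe, top_le_iff] at h1
    exact EReal.add_ne_top hxtop (EReal.coe_ne_top _) h1
  refine ⟨y, hy, (v y).toReal - g y, ?_, fun z hz => ?_⟩
  · rw [sub_add_cancel, EReal.coe_toReal hytop (hbot y hy)]
  · rw [coe_add_le_iff]
    refine le_trans (le_of_eq ?_) (hmin hz : v y + ((-g y : ℝ) : EReal) ≤ _)
    rw [sub_eq_add_neg, EReal.coe_add, EReal.coe_toReal hytop (hbot y hy)]

lemma exists_touching_above {K : Set (Cn n)} (hK : IsCompact K) {v : Cn n → EReal} {g : Cn n → ℝ}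
    (hv : UpperSemicontinuousOn v K) (hg : ContinuousOn g K) (htop : ∀ z ∈ K, v z ≠ ⊤)
    {x : Cn n} (hx : x ∈ K) (hxbot : v x ≠ ⊥) :
    ∃ y ∈ K, ∃ m : ℝ, v y = ((m + g y : ℝ) : EReal) ∧
      ∀ z ∈ K, v z ≤ ((m + g z : ℝ) : EReal) := by
  have husc : UpperSemicontinuousOn (fun z => v z + ((-g z : ℝ) : EReal)) K := by
    refine hv.add' (ContinuousOn.upperSemicontinuousOn
      (continuous_coe_real_ereal.comp_continuousOn hg.neg)) fun z _ => ?_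
    exact EReal.continuousAt_add (.inr (EReal.coe_ne_bot _)) (.inr (EReal.coe_ne_top _))
  obtain ⟨y, hy, hmax⟩ := UpperSemicontinuousOn.exists_isMaxOn ⟨x, hx⟩ hK husc
  have hybot : v y ≠ ⊥ := by
    intro h
    have h1 : v x + ((-g x : ℝ) : EReal) ≤ v y + ((-g y : ℝ) : EReal) := hmax hx
    rw [h, EReal.bot_add, le_bot_iff, EReal.add_eq_bot_iff] at h1
    exact h1.elim hxbot (EReal.coe_ne_bot _)
  refine ⟨y, hy, (v y).toReal - g y, ?_, fun z hz => ?_⟩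
  · rw [sub_add_cancel, EReal.coe_toReal (htop y hy) hybot]
  · rw [le_coe_add_iff]
    refine le_trans (hmax hz : _ ≤ v y + ((-g y : ℝ) : EReal)) (le_of_eq ?_)
    rw [sub_eq_add_neg, EReal.coe_add, EReal.coe_toReal (htop y hy) hybot]

lemma LeviGe.add_norm_sq {u : Cn n → ℝ} {z : Cn n} {c : ℝ} (h : LeviGe u z c) (η b : ℝ) :
    LeviGe (fun x => u x + (η * ‖x‖ ^ 2 + b)) z (c + η) := by
  intro ψ hψ hψz hle ξ
  have hq : ContDiff ℝ 2 fun x : Cn n => ‖x‖ ^ 2 := by simpa using contDiff_norm_sub_sq (0 : Cn n)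
  have hl : levi (fun x : Cn n => ‖x‖ ^ 2) z ξ = ‖ξ‖ ^ 2 := by
    simpa using levi_norm_sub_sq (0 : Cn n) z ξ
  have hq' : ContDiffAt ℝ 2 (fun x : Cn n => -η * ‖x‖ ^ 2) z :=
    (contDiff_const.mul hq).contDiffAt
  have h1 := h (fun x => ψ x + -η * ‖x‖ ^ 2 + -b) ((hψ.add hq').add contDiffAt_const)
    (by simp only [hψz]; ring) (hle.mono fun y hy => by linarith) ξ
  rw [levi_add_const, levi_add hψ hq', levi_const_mul _ hq.contDiffAt, hl] at h1
  linarith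

/-- Uniform strictness near a compact set of an inequality between an upper and a lower
semicontinuous function. -/
lemma exists_forall_lt_of_dist_lt {Ω S : Set (Cn n)} (hΩ : IsOpen Ω) (hS : IsCompact S)
    (hSΩ : S ⊆ Ω) {u : Cn n → ℝ} {v : Cn n → EReal} (hu : UpperSemicontinuousOn u Ω)
    (hv : LowerSemicontinuousOn v Ω) {b η : ℝ} (hη : 0 < η)
    (h : ∀ z ∈ S, ((b + u z : ℝ) : EReal) ≤ v z) :
    ∃ ε > 0, ∀ z ∈ S, ∀ y, dist y z < ε → ((b - η + u y : ℝ) : EReal) < v z := by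
  -- Treating the displacement `d` as a parameter lets compactness of `S` turn local inequalities
  -- into a uniform one.
  have key : ∀ᶠ d in 𝓝 (0 : Cn n), ∀ z ∈ S, ((b - η + u (z + d) : ℝ) : EReal) < v z := by
    refine hS.eventually_forall_of_forall_eventually fun z hz => ?_
    have hadd : Tendsto (fun p : Cn n × Cn n => p.2 + p.1) (𝓝 (0, z)) (𝓝 z) := by
      have : Continuous fun p : Cn n × Cn n => p.2 + p.1 := by fun_prop
      simpa using this.tendsto (0, z)
    have hsnd : Tendsto (fun p : Cn n × Cn n => p.2) (𝓝 (0, z)) (𝓝 z) := continuous_snd.tendsto _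
    have h1 := eventually_lt_of_upperSemicontinuousOn hΩ hu (hSΩ hz)
      (show u z < u z + η / 2 by linarith)
    have h2 := eventually_lt_of_lowerSemicontinuousOn hΩ hv (hSΩ hz)
      (a := ((b - η / 2 + u z : ℝ) : EReal)) (lt_of_lt_of_le (by norm_cast; linarith) (h z hz))
    filter_upwards [hadd.eventually h1, hsnd.eventually h2] with p hp1 hp2
    refine lt_of_le_of_lt ?_ hp2
    norm_cast
    linarith
  obtain ⟨ε, hε, hball⟩ := Metric.eventually_nhds_iff_ball.1 key
  refine ⟨ε, hε, fun z hz y hy => ?_⟩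
  have := hball (y - z) (by simpa [dist_eq_norm] using hy) z hz
  simpa using this

/-- Comparison principle. -/
theorem le_of_isSupersolution (hn : 1 ≤ n) {Ω : Set (Cn n)} (hΩ : IsOpen Ω)
    (hbdd : Bornology.IsBounded Ω) {f : Cn n → ℝ} (hf : ContinuousOn f (closure Ω))
    {u : Cn n → ℝ} {v : Cn n → EReal} (hu : UpperSemicontinuousOn u Ω) {M : ℝ}
    (hM : ∀ z ∈ Ω, |u z| ≤ M) (hsub : ∀ z ∈ Ω, LeviGe u z (f z)) (hv : IsSupersolution Ω f v)
    (hbdry : ∀ η : ℝ, 0 < η → ∃ K, IsCompact K ∧ K ⊆ Ω ∧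
      ∀ z ∈ Ω \ K, ((-η + u z : ℝ) : EReal) ≤ v z) :
    ∀ z ∈ Ω, (u z : EReal) ≤ v z := by
  intro x₀ hx₀
  by_contra! hlt
  obtain ⟨a, ha⟩ : ∃ a : ℝ, v x₀ = a :=
    ⟨(v x₀).toReal, (EReal.coe_toReal (ne_top_of_lt hlt) (hv.ne_bot x₀ hx₀)).symm⟩
  have had : a < u x₀ := by rw [ha] at hlt; exact_mod_cast hlt
  obtain ⟨R, hR⟩ := hbdd.exists_norm_le
  obtain ⟨η, hη, hηd⟩ : ∃ η : ℝ, 0 < η ∧ η * R ^ 2 + 4 * η < u x₀ - a := by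
    have hd : 0 < u x₀ - a := by linarith
    refine ⟨(u x₀ - a) / (R ^ 2 + 5), by positivity, ?_⟩
    have h5 : (u x₀ - a) / (R ^ 2 + 5) * (R ^ 2 + 5) = u x₀ - a :=
      div_mul_cancel₀ _ (by positivity)
    have : 0 < (u x₀ - a) / (R ^ 2 + 5) := by positivity
    linarith
  -- The added term is strictly plurisubharmonic, with Levi form `η ‖ξ‖²`, yet nonpositive on `Ω`,
  -- so the boundary inequality persists.
  let u₁ : Cn n → ℝ := fun x => u x + (η * ‖x‖ ^ 2 + -(η * R ^ 2))
  have hu₁ : UpperSemicontinuousOn u₁ Ω :=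
    hu.add (Continuous.continuousOn (by fun_prop)).upperSemicontinuousOn
  have hqle : ∀ z ∈ Ω, η * ‖z‖ ^ 2 ≤ η * R ^ 2 := fun z hz => by
    have := hR z hz
    gcongr
  have hq0 : ∀ z : Cn n, 0 ≤ η * ‖z‖ ^ 2 := fun z => by positivity
  have hu₁le : ∀ z ∈ Ω, u₁ z ≤ u z := fun z hz => by
    have := hqle z hz
    simp only [u₁]
    linarith
  have hM₁ : ∀ z ∈ Ω, |u₁ z| ≤ M + η * R ^ 2 := fun z hz => by
    have h1 := hqle z hz
    have h2 := hq0 z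
    have h3 := abs_le.1 (hM z hz)
    rw [abs_le]
    simp only [u₁]
    constructor <;> linarith
  have hfu : UniformContinuousOn (fun z => f z + η) Ω := by
    have h1 : UniformContinuousOn (fun z => f z + η) (closure Ω) :=
      hbdd.isCompact_closure.uniformContinuousOn_of_continuous (hf.add continuousOn_const)
    exact h1.mono subset_closure
  obtain ⟨K, hK, hKΩ, hKv⟩ := hbdry η hη
  obtain ⟨K₂, hK₂, hKK₂, hK₂Ω⟩ := exists_compact_between hK hΩ hKΩ
  have hx₀K : x₀ ∈ K := by
    by_contra hx
    have := hKv x₀ ⟨hx₀, hx⟩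
    rw [ha] at this
    norm_cast at this
    have h6 : 0 ≤ η * R ^ 2 := by positivity
    linarith
  obtain ⟨ε₀, hε₀, hclose⟩ := exists_forall_lt_of_dist_lt hΩ (hK₂.diff isOpen_interior)
    (Set.sdiff_subset.trans hK₂Ω) hu₁ hv.lsc (b := -η) hη (fun z hz => by
      have hzΩ := hK₂Ω hz.1
      refine le_trans ?_ (hKv z ⟨hzΩ, fun h => hz.2 (hKK₂ h)⟩)
      have := hu₁le z hzΩ
      norm_cast
      linarith)
  have hε : 0 < min ε₀ (η / 2) := by positivity
  obtain ⟨g, hg, hgK⟩ := exists_smooth_approx hΩ ⟨x₀, hx₀⟩ hu₁ hM₁ hfu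
    (fun z hz => (hsub z hz).add_norm_sq η _) hK₂ hK₂Ω hε
  set ε := min ε₀ (η / 2)
  have hεη : ε ≤ η / 2 := min_le_right _ _
  have hx₀K₂ : x₀ ∈ K₂ := interior_subset (hKK₂ hx₀K)
  obtain ⟨y, hy, m, hym, hmin⟩ := exists_touching_below hK₂ (hv.lsc.mono hK₂Ω)
    hg.continuous.continuousOn (fun z hz => hv.ne_bot z (hK₂Ω hz)) hx₀K₂ (by simp [ha])
  -- The gap at `x₀` exceeds `η R² + 4 η`; the quadratic term costs at most `η R²` and the
  -- approximation at most `η / 2`.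
  have hm : m < -(3 * η) := by
    have h1 := hmin x₀ hx₀K₂
    rw [ha] at h1
    norm_cast at h1
    have h2 := (hgK x₀ hx₀K₂).2.1
    have h3 := hq0 x₀
    simp only [u₁] at h2
    linarith
  -- Outside the interior of `K₂`, `v` exceeds nearby values of `u₁` minus `2 η`, which a translate
  -- lowered by more than `3 η` cannot reach.
  have hyint : y ∈ interior K₂ := by
    by_contra hyint
    obtain ⟨-, -, x, hx, hxy, hgx⟩ := hgK y hy
    have h1 := hclose y ⟨hy, hyint⟩ x (hxy.trans_le (min_le_left _ _))
    rw [hym] at h1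
    norm_cast at h1
    linarith
  have htest := hv.test y (hK₂Ω hy) (fun x => m + g x)
    ⟨contDiffAt_const.add hg.contDiffAt, hym.symm, by
      filter_upwards [mem_interior_iff_mem_nhds.1 hyint] with z hz using hmin z hz⟩
  have hlam : f y + η - ε ≤ lambdaOne (complexHessian (fun x => m + g x) y) := by
    rw [le_lambdaOne_iff hn (contDiffAt_const.add hg.contDiffAt)]
    intro ξ
    have : (fun x => m + g x) = fun x => g x + m := by
      funext x
      ring
    rw [this, levi_add_const]
    exact (hgK y hy).1 ξ
  linarith [le_max_left (lambdaOne (complexHessian (fun x => m + g x) y)) 0]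

/-! ### Closure properties of sub- and supersolutions -/

lemma fderiv_fderiv_nonneg_of_isLocalMin {E : Type*} [NormedAddCommGroup E] [NormedSpace ℝ E]
    {G : E → ℝ} {z : E} (hG : ContDiffAt ℝ 2 G z) (hmin : IsLocalMin G z) (u : E) :
    0 ≤ fderiv ℝ (fderiv ℝ G) z u u := by
  set B := fderiv ℝ (fderiv ℝ G) z with hB
  have key : ∀ ε : ℝ, 0 < ε → -(2 * ε * ‖u‖ ^ 2) ≤ B u u := by
    intro ε hε
    have htend : Tendsto (fun t : ℝ => t • u) (𝓝[≠] 0) (𝓝 0) := by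
      have h : Continuous fun t : ℝ => t • u := by fun_prop
      simpa using (h.tendsto 0).mono_left nhdsWithin_le_nhds
    have htend' : Tendsto (fun t : ℝ => z + t • u) (𝓝[≠] 0) (𝓝 z) := by
      simpa using htend.const_add z
    obtain ⟨t, ⟨h1, h2⟩, ht⟩ := (((htend.eventually (eventually_abs_sub_taylor_two_le hG hε)).and
      (htend'.eventually hmin)).and self_mem_nhdsWithin).exists
    have ht0 : 0 < t ^ 2 := by
      have : t ≠ 0 := ht
      positivity
    rw [hmin.fderiv_eq_zero, ← hB] at h1
    simp only [zero_apply, map_smul, smul_apply, smul_eq_mul, norm_smul,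
      Real.norm_eq_abs, mul_pow, sq_abs] at h1
    have h3 := (abs_le.1 h1).2
    have h4 : t ^ 2 * (-(2 * ε * ‖u‖ ^ 2)) ≤ t ^ 2 * B u u := by nlinarith
    exact le_of_mul_le_mul_left h4 ht0
  by_contra! hneg
  have h0 : 0 < ‖u‖ ^ 2 + 1 := by positivity
  have h1 := key (-(B u u) / (4 * (‖u‖ ^ 2 + 1))) (by apply div_pos <;> linarith)
  have h2 : -(B u u) / (4 * (‖u‖ ^ 2 + 1)) * (‖u‖ ^ 2 + 1) = -(B u u) / 4 := by field_simp
  have h3 : 0 < -(B u u) / (4 * (‖u‖ ^ 2 + 1)) := by apply div_pos <;> linarith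
  nlinarith

lemma levi_le_levi_of_eventually_le {χ ψ : Cn n → ℝ} {z : Cn n} (hχ : ContDiffAt ℝ 2 χ z)
    (hψ : ContDiffAt ℝ 2 ψ z) (hz : ψ z = χ z) (hle : ∀ᶠ y in 𝓝 z, χ y ≤ ψ y) (ξ : Cn n) :
    levi χ z ξ ≤ levi ψ z ξ := by
  have hχ' : ContDiffAt ℝ 2 (fun x => -1 * χ x) z := contDiffAt_const.mul hχ
  have hG : ContDiffAt ℝ 2 (fun x => ψ x + -1 * χ x) z := hψ.add hχ'
  have hmin : IsLocalMin (fun x => ψ x + -1 * χ x) z := by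
    filter_upwards [hle] with y hy
    linarith
  have h : 0 ≤ levi (fun x => ψ x + -1 * χ x) z ξ := by
    have h1 := fderiv_fderiv_nonneg_of_isLocalMin hG hmin ξ
    have h2 := fderiv_fderiv_nonneg_of_isLocalMin hG hmin (Complex.I • ξ)
    simp only [levi, secondDeriv]
    linarith
  rw [levi_add hψ hχ', levi_const_mul _ hχ] at h
  linarith

lemma abs_levi_sub_le (ψ : Cn n → ℝ) (y z ξ : Cn n) :
    |levi ψ y ξ - levi ψ z ξ| ≤
      ‖fderiv ℝ (fderiv ℝ ψ) y - fderiv ℝ (fderiv ℝ ψ) z‖ * ‖ξ‖ ^ 2 := by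
  set D := fderiv ℝ (fderiv ℝ ψ) y - fderiv ℝ (fderiv ℝ ψ) z with hD
  have h1 : ∀ a : Cn n, |D a a| ≤ ‖D‖ * ‖a‖ ^ 2 := fun a => by
    have := D.le_opNorm₂ a a
    rwa [Real.norm_eq_abs, mul_assoc, ← pow_two] at this
  have h2 : levi ψ y ξ - levi ψ z ξ = (D ξ ξ + D (Complex.I • ξ) (Complex.I • ξ)) / 4 := by
    simp only [levi, secondDeriv, hD, sub_apply]
    ring
  have h3 := abs_le.1 (h1 ξ)
  have h4 := abs_le.1 (h1 (Complex.I • ξ))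
  have h5 : 0 ≤ ‖D‖ * ‖ξ‖ ^ 2 := by positivity
  simp only [norm_smul, Complex.norm_I, one_mul] at h4
  rw [h2, abs_le]
  constructor <;> linarith

lemma continuousAt_fderiv_fderiv {E : Type*} [NormedAddCommGroup E] [NormedSpace ℝ E]
    {ψ : E → ℝ} {z : E} (hψ : ContDiffAt ℝ 2 ψ z) :
    ContinuousAt (fderiv ℝ (fderiv ℝ ψ)) z :=
  ((hψ.fderiv_right (m := 1) (by norm_num)).fderiv_right (m := 0) (by norm_num)).continuousAt

lemma eventually_norm_fderiv_fderiv_sub_lt {E : Type*} [NormedAddCommGroup E] [NormedSpace ℝ E]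
    {ψ : E → ℝ} {z : E} (hψ : ContDiffAt ℝ 2 ψ z) {γ : ℝ} (hγ : 0 < γ) :
    ∀ᶠ y in 𝓝 z, ‖fderiv ℝ (fderiv ℝ ψ) y - fderiv ℝ (fderiv ℝ ψ) z‖ < γ := by
  filter_upwards [(Metric.tendsto_nhds (α := E →L[ℝ] E →L[ℝ] ℝ)).1
    (continuousAt_fderiv_fderiv hψ) γ hγ] with y hy
  exact (dist_eq_norm (fderiv ℝ (fderiv ℝ ψ) y) (fderiv ℝ (fderiv ℝ ψ) z)).symm.trans_lt hy

lemma eventually_abs_levi_sub_le {ψ : Cn n → ℝ} {z : Cn n} (hψ : ContDiffAt ℝ 2 ψ z) {γ : ℝ}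
    (hγ : 0 < γ) : ∀ᶠ y in 𝓝 z, ∀ ξ, |levi ψ y ξ - levi ψ z ξ| ≤ γ * ‖ξ‖ ^ 2 := by
  filter_upwards [eventually_norm_fderiv_fderiv_sub_lt hψ hγ] with y hy ξ
  refine (abs_levi_sub_le ψ y z ξ).trans ?_
  gcongr

/-! ### Extended-real sub- and supersolutions. -/

section Extended

variable {Ω : Set (Cn n)} {f : Cn n → ℝ}

lemma IsSubsolution.le_levi (hn : 1 ≤ n) {v : Cn n → EReal} (hv : IsSubsolution Ω f v) {z : Cn n}
    (hz : z ∈ Ω) {ψ : Cn n → ℝ} (hψ : TouchesAbove ψ v z) (ξ : Cn n) :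
    f z * ‖ξ‖ ^ 2 ≤ levi ψ z ξ :=
  (le_lambdaOne_iff hn hψ.1 _).1 (hv.test z hz ψ hψ) ξ

lemma IsSubsolution.congr (hΩ : IsOpen Ω) {u v : Cn n → EReal} (hu : IsSubsolution Ω f u)
    (h : Set.EqOn v u Ω) : IsSubsolution Ω f v where
  usc z hz a ha := by
    have ha : v z < a := ha
    rw [h hz] at ha
    filter_upwards [hu.usc z hz a ha, self_mem_nhdsWithin] with y hy hyΩ
    rwa [h hyΩ]
  ne_top z hz := h hz ▸ hu.ne_top z hz
  proper := by
    obtain ⟨z, hz, hzb⟩ := hu.proper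
    exact ⟨z, hz, h hz ▸ hzb⟩
  test z hz ψ hψ := hu.test z hz ψ ⟨hψ.1, by rw [hψ.2.1, h hz], by
    filter_upwards [hψ.2.2, hΩ.mem_nhds hz] with y hy hyΩ
    rwa [← h hyΩ]⟩

lemma IsSupersolution.congr (hΩ : IsOpen Ω) {u v : Cn n → EReal} (hu : IsSupersolution Ω f u)
    (h : Set.EqOn v u Ω) : IsSupersolution Ω f v where
  lsc z hz a ha := by
    have ha : a < v z := ha
    rw [h hz] at ha
    filter_upwards [hu.lsc z hz a ha, self_mem_nhdsWithin] with y hy hyΩ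
    rwa [h hyΩ]
  ne_bot z hz := h hz ▸ hu.ne_bot z hz
  proper := by
    obtain ⟨z, hz, hzb⟩ := hu.proper
    exact ⟨z, hz, h hz ▸ hzb⟩
  test z hz ψ hψ := hu.test z hz ψ ⟨hψ.1, by rw [hψ.2.1, h hz], by
    filter_upwards [hψ.2.2, hΩ.mem_nhds hz] with y hy hyΩ
    rwa [← h hyΩ]⟩

lemma isSubsolution_coe_of_levi (hn : 1 ≤ n) (hne : Ω.Nonempty) {χ : Cn n → ℝ}
    (hχ : ContDiff ℝ 2 χ) (h : ∀ z ∈ Ω, ∀ ξ, f z * ‖ξ‖ ^ 2 ≤ levi χ z ξ) :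
    IsSubsolution Ω f (fun z => (χ z : EReal)) where
  usc := (continuous_coe_real_ereal.comp hχ.continuous).continuousOn.upperSemicontinuousOn
  ne_top _ _ := EReal.coe_ne_top _
  proper := hne.imp fun _ hz => ⟨hz, EReal.coe_ne_bot _⟩
  test z hz ψ hψ := by
    rw [le_lambdaOne_iff hn hψ.1]
    refine fun ξ => (h z hz ξ).trans (levi_le_levi_of_eventually_le hχ.contDiffAt hψ.1
      (EReal.coe_injective hψ.2.1) ?_ ξ)
    filter_upwards [hψ.2.2] with y hy
    exact_mod_cast hy

lemma IsSubsolution.sup {u v : Cn n → EReal} (hu : IsSubsolution Ω f u)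
    (hv : IsSubsolution Ω f v) : IsSubsolution Ω f (fun z => max (u z) (v z)) where
  usc := hu.usc.sup hv.usc
  ne_top z hz := by
    have h1 := (hu.ne_top z hz).lt_top
    have h2 := (hv.ne_top z hz).lt_top
    exact (max_lt h1 h2).ne
  proper := by
    obtain ⟨z, hz, hzb⟩ := hu.proper
    exact ⟨z, hz, fun h => hzb (le_bot_iff.1 (h ▸ le_max_left _ _))⟩
  test z hz ψ hψ := by
    rcases max_choice (u z) (v z) with h | h
    · exact hu.test z hz ψ ⟨hψ.1, hψ.2.1.trans h, hψ.2.2.mono fun y hy => (le_max_left _ _).trans hy⟩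
    · exact hv.test z hz ψ ⟨hψ.1, hψ.2.1.trans h,
        hψ.2.2.mono fun y hy => (le_max_right _ _).trans hy⟩

/-- A function touching a constant from below has nonpositive Levi form there, and `f > 0`. Such
constants bound the Perron family from above. -/
lemma isSupersolution_const (hn : 1 ≤ n) (hne : Ω.Nonempty) (hf : ∀ z ∈ Ω, 0 < f z) (C : ℝ) :
    IsSupersolution Ω f (fun _ => (C : EReal)) where
  lsc := continuousOn_const.lowerSemicontinuousOn
  ne_bot _ _ := EReal.coe_ne_bot _
  proper := hne.imp fun _ hz => ⟨hz, EReal.coe_ne_top _⟩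
  test z hz ψ hψ := by
    refine max_le ?_ (hf z hz).le
    have h1 := (le_lambdaOne_iff hn hψ.1 _).1 le_rfl (EuclideanSpace.single ⟨0, hn⟩ 1)
    have h2 := levi_le_levi_of_eventually_le hψ.1 (contDiffAt_const (c := C))
      (EReal.coe_injective hψ.2.1.symm) (by
        filter_upwards [hψ.2.2] with y hy
        exact_mod_cast hy) (EuclideanSpace.single ⟨0, hn⟩ 1)
    have h3 : levi (fun _ : Cn n => C) z (EuclideanSpace.single ⟨0, hn⟩ 1) = 0 := by
      simp [levi, secondDeriv]
    simp only [PiLp.norm_single, norm_one, one_pow, mul_one] at h1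
    linarith [hf z hz]

lemma exists_compact_of_eventually_frontier (hΩ : IsOpen Ω) (hbdd : Bornology.IsBounded Ω)
    {p : Cn n → Prop} (h : ∀ ζ ∈ frontier Ω, ∀ᶠ z in 𝓝[Ω] ζ, p z) :
    ∃ K, IsCompact K ∧ K ⊆ Ω ∧ ∀ z ∈ Ω \ K, p z := by
  have h' : ∀ ζ ∈ frontier Ω, ∃ N, IsOpen N ∧ ζ ∈ N ∧ ∀ z ∈ N ∩ Ω, p z := fun ζ hζ => by
    obtain ⟨N, hN, hζN, hNp⟩ := mem_nhdsWithin.1 (h ζ hζ)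
    exact ⟨N, hN, hζN, fun z hz => hNp hz⟩
  choose! N hN hζN hNp using h'
  have hopen : IsOpen (⋃ ζ ∈ frontier Ω, N ζ) := isOpen_biUnion hN
  refine ⟨closure Ω \ ⋃ ζ ∈ frontier Ω, N ζ, hbdd.isCompact_closure.diff hopen, ?_, ?_⟩
  · rintro z ⟨hz, hzN⟩
    by_contra hzΩ
    have hzf : z ∈ frontier Ω := ⟨hz, by rwa [hΩ.interior_eq]⟩
    exact hzN (Set.mem_biUnion hzf (hζN z hzf))
  · rintro z ⟨hz, hzK⟩
    have : z ∈ ⋃ ζ ∈ frontier Ω, N ζ := by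
      by_contra hzN
      exact hzK ⟨subset_closure hz, hzN⟩
    obtain ⟨ζ, hζ, hzζ⟩ := Set.mem_iUnion₂.1 this
    exact hNp ζ hζ z ⟨hzζ, hz⟩

/-- Bounded from above and below by real constants on `Ω`. -/
def BoundedOn (Ω : Set (Cn n)) (v : Cn n → EReal) : Prop :=
  ∃ M : ℝ, ∀ z ∈ Ω, ((-M : ℝ) : EReal) ≤ v z ∧ v z ≤ (M : EReal)

lemma boundedOn_of_le {v : Cn n → EReal} {a b : ℝ}
    (h : ∀ z ∈ Ω, (a : EReal) ≤ v z ∧ v z ≤ (b : EReal)) : BoundedOn Ω v := by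
  refine ⟨max |a| |b|, fun z hz => ⟨le_trans ?_ (h z hz).1, (h z hz).2.trans ?_⟩⟩ <;> norm_cast
  · linarith [neg_abs_le a, le_max_left |a| |b|]
  · exact (le_abs_self b).trans (le_max_right _ _)

/-- Comparison principle for extended-real functions separated at the boundary by a real function. -/
lemma IsSubsolution.le_supersolution (hn : 1 ≤ n) (hΩ : IsOpen Ω) (hbdd : Bornology.IsBounded Ω)
    (hf : ContinuousOn f (closure Ω)) {u v : Cn n → EReal} (hu : IsSubsolution Ω f u)
    (hub : BoundedOn Ω u) (hv : IsSupersolution Ω f v)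
    (hbdry : ∀ ζ ∈ frontier Ω, ∃ p : ℝ, (∀ a : ℝ, p < a → ∀ᶠ z in 𝓝[Ω] ζ, u z < a) ∧
      ∀ a : ℝ, a < p → ∀ᶠ z in 𝓝[Ω] ζ, (a : EReal) < v z) :
    ∀ z ∈ Ω, u z ≤ v z := by
  obtain ⟨M, hM⟩ := hub
  have hcoe : ∀ z ∈ Ω, (((u z).toReal : ℝ) : EReal) = u z := fun z hz =>
    EReal.coe_toReal (hu.ne_top z hz) fun h => by
      have := (hM z hz).1
      rw [h, le_bot_iff] at this
      exact EReal.coe_ne_bot _ this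
  have hcmp := le_of_isSupersolution hn hΩ hbdd hf (u := fun z => (u z).toReal) (v := v) (M := M)
    (fun z hz a ha => by
      have h1 : u z < (a : EReal) := by
        rw [← hcoe z hz]
        exact_mod_cast ha
      filter_upwards [hu.usc z hz a h1, self_mem_nhdsWithin] with y hy hyΩ
      rw [← hcoe y hyΩ] at hy
      exact_mod_cast hy)
    (fun z hz => by
      have h1 := hM z hz
      rw [← hcoe z hz] at h1
      norm_cast at h1
      exact abs_le.2 h1)
    (fun z hz ψ hψ hψz hle ξ => hu.le_levi hn hz ⟨hψ, by rw [hψz, hcoe z hz], by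
      filter_upwards [hle, hΩ.mem_nhds hz] with y hy hyΩ
      rw [← hcoe y hyΩ]
      exact_mod_cast hy⟩ ξ) hv
    (fun η hη => exists_compact_of_eventually_frontier hΩ hbdd fun ζ hζ => by
      obtain ⟨p, h1, h2⟩ := hbdry ζ hζ
      filter_upwards [h1 (p + η / 2) (by linarith), h2 (p - η / 2) (by linarith),
        self_mem_nhdsWithin] with z hz1 hz2 hzΩ
      rw [← hcoe z hzΩ] at hz1
      refine le_trans ?_ hz2.le
      norm_cast at hz1 ⊢
      linarith)
  intro z hz
  rw [← hcoe z hz]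
  exact hcmp z hz

end Extended

/-! ### Semicontinuous envelopes -/

section Perron

variable {Ω : Set (Cn n)}

section Envelopes

variable {u v : Cn n → EReal} {z : Cn n} {a : EReal}

lemma uscEnvelope_lt_iff :
    uscEnvelope Ω u z < a ↔ ∃ r : ℝ, 0 < r ∧ ⨆ y ∈ Ω ∩ Metric.ball z r, u y < a := by
  simp only [uscEnvelope, iInf_lt_iff, exists_prop]

lemma lt_lscEnvelope_iff :
    a < lscEnvelope Ω u z ↔ ∃ r : ℝ, 0 < r ∧ a < ⨅ y ∈ Ω ∩ Metric.ball z r, u y := by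
  simp only [lscEnvelope, lt_iSup_iff, exists_prop]

lemma eventually_lt_of_uscEnvelope_lt (h : uscEnvelope Ω u z < a) : ∀ᶠ y in 𝓝[Ω] z, u y < a := by
  obtain ⟨r, hr, h⟩ := uscEnvelope_lt_iff.1 h
  filter_upwards [self_mem_nhdsWithin, mem_nhdsWithin_of_mem_nhds (Metric.ball_mem_nhds z hr)]
    with y hy hyr
  exact (le_iSup₂ (f := fun y (_ : y ∈ Ω ∩ Metric.ball z r) => u y) y ⟨hy, hyr⟩).trans_lt h

lemma eventually_lt_of_lt_lscEnvelope (h : a < lscEnvelope Ω u z) : ∀ᶠ y in 𝓝[Ω] z, a < u y := by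
  obtain ⟨r, hr, h⟩ := lt_lscEnvelope_iff.1 h
  filter_upwards [self_mem_nhdsWithin, mem_nhdsWithin_of_mem_nhds (Metric.ball_mem_nhds z hr)]
    with y hy hyr
  exact h.trans_le (iInf₂_le (f := fun y (_ : y ∈ Ω ∩ Metric.ball z r) => u y) y ⟨hy, hyr⟩)

lemma uscEnvelope_le_of_eventually (h : ∀ᶠ y in 𝓝[Ω] z, u y ≤ a) : uscEnvelope Ω u z ≤ a := by
  obtain ⟨r, hr, h⟩ := Metric.mem_nhdsWithin_iff.1 h
  exact (iInf₂_le r hr).trans (iSup₂_le fun y hy => h ⟨hy.2, hy.1⟩)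

lemma le_lscEnvelope_of_eventually (h : ∀ᶠ y in 𝓝[Ω] z, a ≤ u y) : a ≤ lscEnvelope Ω u z := by
  obtain ⟨r, hr, h⟩ := Metric.mem_nhdsWithin_iff.1 h
  exact le_trans (le_iInf₂ fun y hy => h ⟨hy.2, hy.1⟩) (le_iSup₂ (f := fun r (_ : 0 < r) =>
    ⨅ y ∈ Ω ∩ Metric.ball z r, u y) r hr)

lemma le_uscEnvelope (hz : z ∈ Ω) : u z ≤ uscEnvelope Ω u z :=
  le_iInf₂ fun r hr => le_iSup₂ (f := fun y (_ : y ∈ Ω ∩ Metric.ball z r) => u y) z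
    ⟨hz, Metric.mem_ball_self hr⟩

lemma lscEnvelope_le (hz : z ∈ Ω) : lscEnvelope Ω u z ≤ u z :=
  iSup₂_le fun r hr => iInf₂_le (f := fun y (_ : y ∈ Ω ∩ Metric.ball z r) => u y) z
    ⟨hz, Metric.mem_ball_self hr⟩

lemma eventually_uscEnvelope_le (h : ∀ᶠ y in 𝓝[Ω] z, u y ≤ a) :
    ∀ᶠ y in 𝓝[Ω] z, uscEnvelope Ω u y ≤ a := by
  filter_upwards [eventually_eventually_nhdsWithin.2 h] with y hy
  exact uscEnvelope_le_of_eventually hy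

lemma eventually_le_lscEnvelope (h : ∀ᶠ y in 𝓝[Ω] z, a ≤ u y) :
    ∀ᶠ y in 𝓝[Ω] z, a ≤ lscEnvelope Ω u y := by
  filter_upwards [eventually_eventually_nhdsWithin.2 h] with y hy
  exact le_lscEnvelope_of_eventually hy

lemma upperSemicontinuousOn_uscEnvelope :
    UpperSemicontinuousOn (uscEnvelope Ω u) Ω := by
  intro z hz a ha
  obtain ⟨b, hb, hba⟩ := exists_between (show uscEnvelope Ω u z < a from ha)
  filter_upwards [eventually_uscEnvelope_le ((eventually_lt_of_uscEnvelope_lt hb).mono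
    fun _ => le_of_lt)] with y hy
  exact hy.trans_lt hba

lemma lowerSemicontinuousOn_lscEnvelope :
    LowerSemicontinuousOn (lscEnvelope Ω u) Ω := by
  intro z hz a ha
  obtain ⟨b, hab, hb⟩ := exists_between (show a < lscEnvelope Ω u z from ha)
  filter_upwards [eventually_le_lscEnvelope ((eventually_lt_of_lt_lscEnvelope hb).mono
    fun _ => le_of_lt)] with y hy
  exact hab.trans_le hy

lemma lscEnvelope_le_uscEnvelope (hz : z ∈ closure Ω) :
    lscEnvelope Ω u z ≤ uscEnvelope Ω u z := by
  have : (𝓝[Ω] z).NeBot := mem_closure_iff_nhdsWithin_neBot.1 hz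
  refine le_of_forall_lt fun c hc => ?_
  by_contra! hle
  obtain ⟨b, hcb, hb⟩ := exists_between hc
  obtain ⟨y, hy1, hy2⟩ := ((eventually_lt_of_uscEnvelope_lt (hle.trans_lt hcb)).and
    (eventually_lt_of_lt_lscEnvelope hb)).exists
  exact lt_asymm hy1 hy2

lemma tendsto_of_envelopes_eq (h1 : uscEnvelope Ω u z ≤ a) (h2 : a ≤ lscEnvelope Ω u z) :
    Tendsto u (𝓝[Ω] z) (𝓝 a) :=
  tendsto_order.2 ⟨fun _ hb => eventually_lt_of_lt_lscEnvelope (hb.trans_le h2),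
    fun _ hb => eventually_lt_of_uscEnvelope_lt (h1.trans_lt hb)⟩

lemma HasBoundaryValues.uscEnvelope {φ : Cn n → ℝ} (h : HasBoundaryValues Ω u φ) :
    HasBoundaryValues Ω (uscEnvelope Ω u) φ := by
  intro ζ hζ
  refine tendsto_order.2 ⟨fun b hb => ?_, fun b hb => ?_⟩
  · filter_upwards [(tendsto_order.1 (h ζ hζ)).1 b hb, self_mem_nhdsWithin] with y hy hyΩ
    exact hy.trans_le (le_uscEnvelope hyΩ)
  · obtain ⟨c, hc, hcb⟩ := exists_between hb
    filter_upwards [eventually_uscEnvelope_le (((tendsto_order.1 (h ζ hζ)).2 c hc).mono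
      fun _ => le_of_lt)] with y hy
    exact hy.trans_lt hcb

lemma HasBoundaryValues.lscEnvelope {φ : Cn n → ℝ} (h : HasBoundaryValues Ω u φ) :
    HasBoundaryValues Ω (lscEnvelope Ω u) φ := by
  intro ζ hζ
  refine tendsto_order.2 ⟨fun b hb => ?_, fun b hb => ?_⟩
  · obtain ⟨c, hbc, hc⟩ := exists_between hb
    filter_upwards [eventually_le_lscEnvelope (((tendsto_order.1 (h ζ hζ)).1 c hc).mono
      fun _ => le_of_lt)] with y hy
    exact hbc.trans_le hy
  · filter_upwards [(tendsto_order.1 (h ζ hζ)).2 b hb, self_mem_nhdsWithin] with y hy hyΩ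
    exact (lscEnvelope_le hyΩ).trans_lt hy

end Envelopes

/-- The upper envelope of a supremum of subsolutions is a subsolution. -/
lemma isSubsolution_uscEnvelope_iSup (hn : 1 ≤ n) (hΩ : IsOpen Ω) {f : Cn n → ℝ}
    (hf : ContinuousOn f Ω) {F : Set (Cn n → EReal)} (hF : ∀ v ∈ F, IsSubsolution Ω f v)
    (htop : ∀ z ∈ Ω, uscEnvelope Ω (fun z => ⨆ v ∈ F, v z) z ≠ ⊤)
    (hproper : ∃ z ∈ Ω, uscEnvelope Ω (fun z => ⨆ v ∈ F, v z) z ≠ ⊥) :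
    IsSubsolution Ω f (uscEnvelope Ω (fun z => ⨆ v ∈ F, v z)) where
  usc := upperSemicontinuousOn_uscEnvelope
  ne_top := htop
  proper := hproper
  test z₀ hz₀ ψ hψ := by
    obtain ⟨hψ2, hψz₀, hψle⟩ := hψ
    set U : Cn n → EReal := fun z => ⨆ v ∈ F, v z with hU
    rw [le_lambdaOne_iff hn hψ2]
    intro ξ
    by_contra! hlt
    obtain ⟨γ, hγ, hγlt⟩ : ∃ γ : ℝ, 0 < γ ∧ levi ψ z₀ ξ + γ * ‖ξ‖ ^ 2 < f z₀ * ‖ξ‖ ^ 2 := by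
      have h0 : 0 < f z₀ * ‖ξ‖ ^ 2 - levi ψ z₀ ξ := by linarith
      refine ⟨(f z₀ * ‖ξ‖ ^ 2 - levi ψ z₀ ξ) / (‖ξ‖ ^ 2 + 1), by positivity, ?_⟩
      have h1 : (f z₀ * ‖ξ‖ ^ 2 - levi ψ z₀ ξ) / (‖ξ‖ ^ 2 + 1) * (‖ξ‖ ^ 2 + 1) =
        f z₀ * ‖ξ‖ ^ 2 - levi ψ z₀ ξ := div_mul_cancel₀ _ (by positivity)
      have h2 : 0 < (f z₀ * ‖ξ‖ ^ 2 - levi ψ z₀ ξ) / (‖ξ‖ ^ 2 + 1) := by positivity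
      linarith
    have hq := contDiff_norm_sub_sq z₀
    -- The quadratic term makes the contact strict while `γ` is small enough to keep the Levi
    -- inequality violated in direction `ξ` near `z₀`.
    let χ : Cn n → ℝ := fun x => ψ x + γ * ‖x - z₀‖ ^ 2
    have hfz : ContinuousAt f z₀ := hf.continuousAt (hΩ.mem_nhds hz₀)
    have hlevi : ContinuousAt (fun y => levi ψ y ξ) z₀ := by
      have h := continuousAt_fderiv_fderiv hψ2
      simp only [levi, secondDeriv]
      exact (((h.clm_apply continuousAt_const).clm_apply continuousAt_const).add
        ((h.clm_apply continuousAt_const).clm_apply continuousAt_const)).div_const 4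
    have hev : ∀ᶠ y in 𝓝 z₀, levi ψ y ξ + γ * ‖ξ‖ ^ 2 < f y * ‖ξ‖ ^ 2 :=
      (hlevi.add continuousAt_const).eventually_lt (hfz.mul continuousAt_const) hγlt
    obtain ⟨r, hr, hball⟩ := Metric.nhds_basis_closedBall.eventually_iff.1
      (hev.and (hψle.and ((hψ2.eventually (by simp)).and (hΩ.mem_nhds hz₀))))
    have hχ2 : ∀ y ∈ Metric.closedBall z₀ r, ContDiffAt ℝ 2 χ y := fun y hy =>
      (hball hy).2.2.1.add (contDiff_const.mul hq).contDiffAt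
    have hγr : 0 < γ * r ^ 2 := by positivity
    -- Otherwise the upper envelope at `z₀` would be at most `ψ z₀ - γ r² / 2`. Some member `v` of
    -- the family thus exceeds `χ - γ r²` at `z`.
    obtain ⟨z, hz, hzU⟩ : ∃ z ∈ Metric.closedBall z₀ r, ((χ z - γ * r ^ 2 : ℝ) : EReal) < U z := by
      by_contra! hcon
      have hχc : ContinuousAt χ z₀ := (hχ2 z₀ (Metric.mem_closedBall_self hr.le)).continuousAt
      have h1 : ∀ᶠ y in 𝓝 z₀, χ y < ψ z₀ + γ * r ^ 2 / 2 :=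
        hχc.eventually_lt continuousAt_const (by simp only [χ, sub_self, norm_zero]; linarith)
      have h2 : uscEnvelope Ω U z₀ ≤ ((ψ z₀ - γ * r ^ 2 / 2 : ℝ) : EReal) := by
        refine uscEnvelope_le_of_eventually (mem_nhdsWithin_of_mem_nhds ?_)
        filter_upwards [h1, Metric.closedBall_mem_nhds z₀ hr] with y hy hyr
        refine (hcon y hyr).trans ?_
        norm_cast
        linarith
      rw [← hψz₀] at h2
      norm_cast at h2
      linarith
    obtain ⟨v, hv⟩ := lt_iSup_iff.1 hzU
    obtain ⟨hvF, hv⟩ := lt_iSup_iff.1 hv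
    have hvsub := hF v hvF
    have hsubΩ : Metric.closedBall z₀ r ⊆ Ω := fun y hy => (hball hy).2.2.2
    obtain ⟨y, hy, m, hym, hmax⟩ := exists_touching_above (isCompact_closedBall z₀ r)
      (hvsub.usc.mono hsubΩ) (fun y hy => (hχ2 y hy).continuousAt.continuousWithinAt)
      (fun y hy => hvsub.ne_top y (hsubΩ hy)) hz (ne_bot_of_gt hv)
    have hm : -(γ * r ^ 2) < m := by
      have h := hv.trans_le (hmax z hz)
      norm_cast at h
      linarith
    have hvU : v y ≤ (ψ y : EReal) := calc
      v y ≤ U y := le_iSup₂ (f := fun v (_ : v ∈ F) => v y) v hvF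
      _ ≤ uscEnvelope Ω U y := le_uscEnvelope (hsubΩ hy)
      _ ≤ ψ y := (hball hy).2.1
    -- On the sphere `χ + m > ψ`, whereas `v ≤ ψ`; contact is therefore interior.
    have hyr : dist y z₀ < r := by
      refine lt_of_le_of_ne hy fun heq => ?_
      rw [hym] at hvU
      norm_cast at hvU
      rw [dist_eq_norm] at heq
      simp only [χ, heq] at hvU
      linarith
    have htouch : TouchesAbove (fun x => χ x + m) v y :=
      ⟨(hχ2 y hy).add contDiffAt_const, by rw [hym, add_comm], by
        filter_upwards [Metric.isOpen_ball.mem_nhds (Metric.mem_ball.2 hyr)] with x hx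
        rw [add_comm]
        exact hmax x (Metric.ball_subset_closedBall hx)⟩
    have h := hvsub.le_levi hn (hsubΩ hy) htouch ξ
    rw [levi_add_const, levi_add (hball hy).2.2.1 (contDiff_const.mul hq).contDiffAt,
      levi_const_mul γ hq.contDiffAt, levi_norm_sub_sq] at h
    linarith [(hball hy).1]

/-! ### Perron's method -/

variable {f φ : Cn n → ℝ} {lo hi : Cn n → EReal}

lemma exists_forall_le_of_hasBoundaryValues (hΩ : IsOpen Ω) (hbdd : Bornology.IsBounded Ω)
    (hφ : ContinuousOn φ (frontier Ω)) {v : Cn n → EReal} (husc : UpperSemicontinuousOn v Ω)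
    (htop : ∀ z ∈ Ω, v z ≠ ⊤) (hv : HasBoundaryValues Ω v φ) :
    ∃ C : ℝ, ∀ z ∈ Ω, v z ≤ (C : EReal) := by
  have hcpt : IsCompact (frontier Ω) :=
    hbdd.isCompact_closure.of_isClosed_subset isClosed_frontier frontier_subset_closure
  obtain ⟨C₁, hC₁⟩ := hcpt.bddAbove_image hφ
  obtain ⟨K, hK, hKΩ, hKv⟩ := exists_compact_of_eventually_frontier hΩ hbdd
    (p := fun z => v z < ((C₁ + 1 : ℝ) : EReal)) fun ζ hζ => by
      refine (tendsto_order.1 (hv ζ hζ)).2 _ ?_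
      have := hC₁ (Set.mem_image_of_mem _ hζ)
      norm_cast
      linarith
  rcases K.eq_empty_or_nonempty with rfl | hne
  · exact ⟨C₁ + 1, fun z hz => (hKv z ⟨hz, id⟩).le⟩
  · obtain ⟨y, hy, hmax⟩ := UpperSemicontinuousOn.exists_isMaxOn hne hK (husc.mono hKΩ)
    refine ⟨max (C₁ + 1) (v y).toReal, fun z hz => ?_⟩
    by_cases hzK : z ∈ K
    · refine (hmax hzK : v z ≤ v y).trans ((EReal.le_coe_toReal (htop y (hKΩ hy))).trans ?_)
      exact_mod_cast le_max_right _ _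
    · refine (hKv z ⟨hz, hzK⟩).le.trans ?_
      exact_mod_cast le_max_left _ _

lemma exists_forall_ge_of_hasBoundaryValues (hΩ : IsOpen Ω) (hbdd : Bornology.IsBounded Ω)
    (hφ : ContinuousOn φ (frontier Ω)) {v : Cn n → EReal} (hlsc : LowerSemicontinuousOn v Ω)
    (hbot : ∀ z ∈ Ω, v z ≠ ⊥) (hv : HasBoundaryValues Ω v φ) :
    ∃ C : ℝ, ∀ z ∈ Ω, (C : EReal) ≤ v z := by
  have hcpt : IsCompact (frontier Ω) :=
    hbdd.isCompact_closure.of_isClosed_subset isClosed_frontier frontier_subset_closure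
  obtain ⟨C₁, hC₁⟩ := hcpt.bddBelow_image hφ
  obtain ⟨K, hK, hKΩ, hKv⟩ := exists_compact_of_eventually_frontier hΩ hbdd
    (p := fun z => ((C₁ - 1 : ℝ) : EReal) < v z) fun ζ hζ => by
      refine (tendsto_order.1 (hv ζ hζ)).1 _ ?_
      have := hC₁ (Set.mem_image_of_mem _ hζ)
      norm_cast
      linarith
  rcases K.eq_empty_or_nonempty with rfl | hne
  · exact ⟨C₁ - 1, fun z hz => (hKv z ⟨hz, id⟩).le⟩
  · obtain ⟨y, hy, hmin⟩ := LowerSemicontinuousOn.exists_isMinOn hne hK (hlsc.mono hKΩ)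
    refine ⟨min (C₁ - 1) (v y).toReal, fun z hz => ?_⟩
    by_cases hzK : z ∈ K
    · refine le_trans ?_ ((EReal.coe_toReal_le (hbot y (hKΩ hy))).trans (hmin hzK : v y ≤ v z))
      exact_mod_cast min_le_right _ _
    · refine le_trans ?_ (hKv z ⟨hz, hzK⟩).le
      exact_mod_cast min_le_left _ _

/-- Comparison of sub- and supersolutions with the same continuous boundary values. -/
lemma IsSubsolution.le_of_hasBoundaryValues (hn : 1 ≤ n) (hΩ : IsOpen Ω)
    (hbdd : Bornology.IsBounded Ω) (hf : ContinuousOn f (closure Ω)) {u v : Cn n → EReal}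
    (hu : IsSubsolution Ω f u) (hub : BoundedOn Ω u) (hv : IsSupersolution Ω f v)
    (huφ : HasBoundaryValues Ω u φ) (hvφ : HasBoundaryValues Ω v φ) : ∀ z ∈ Ω, u z ≤ v z :=
  hu.le_supersolution hn hΩ hbdd hf hub hv fun ζ hζ =>
    ⟨φ ζ, fun a ha => (tendsto_order.1 (huφ ζ hζ)).2 a (by exact_mod_cast ha),
      fun a ha => (tendsto_order.1 (hvφ ζ hζ)).1 a (by exact_mod_cast ha)⟩

lemma HasBoundaryValues.of_between {u v w : Cn n → EReal} (hu : HasBoundaryValues Ω u φ)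
    (hw : HasBoundaryValues Ω w φ) (h : ∀ z ∈ Ω, u z ≤ v z ∧ v z ≤ w z) :
    HasBoundaryValues Ω v φ := fun ζ hζ =>
  tendsto_of_tendsto_of_tendsto_of_le_of_le' (hu ζ hζ) (hw ζ hζ)
    (eventually_mem_nhdsWithin.mono fun z hz => (h z hz).1)
    (eventually_mem_nhdsWithin.mono fun z hz => (h z hz).2)

/-- A subsolution may be replaced, on a ball, by its maximum with a smooth strict subsolution that
lies below it near the boundary of the ball. -/
lemma IsSubsolution.glue_ball (hn : 1 ≤ n) {U : Cn n → EReal}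
    (hU : IsSubsolution Ω f U) {χ : Cn n → ℝ} {z₀ : Cn n} {r s : ℝ} (hsr : s < r)
    (hχ : ∀ y ∈ Metric.ball z₀ r, ContDiffAt ℝ 2 χ y)
    (hlevi : ∀ y ∈ Metric.ball z₀ r, ∀ ξ, f y * ‖ξ‖ ^ 2 ≤ levi χ y ξ)
    (hle : ∀ y ∈ Metric.ball z₀ r, s ≤ dist y z₀ → (χ y : EReal) ≤ U y) {V : Cn n → EReal}
    (hV : ∀ y ∈ Metric.ball z₀ r, V y = max (U y) (χ y))
    (hV' : ∀ y ∉ Metric.ball z₀ r, V y = U y) : IsSubsolution Ω f V := by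
  have hUV : ∀ y, U y ≤ V y := fun y => by
    by_cases hy : y ∈ Metric.ball z₀ r
    · rw [hV y hy]
      exact le_max_left _ _
    · rw [hV' y hy]
  refine ⟨fun z hz a ha => ?_, fun z hz => ?_, ?_, fun z hz ψ hψ => ?_⟩
  · have ha : V z < a := ha
    by_cases hzr : z ∈ Metric.ball z₀ r
    · rw [hV z hzr, max_lt_iff] at ha
      have h1 : ∀ᶠ y in 𝓝 z, (χ y : EReal) < a :=
        (continuous_coe_real_ereal.continuousAt.comp (hχ z hzr).continuousAt).eventually_lt
          continuousAt_const ha.2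
      filter_upwards [hU.usc z hz a ha.1, mem_nhdsWithin_of_mem_nhds h1,
        mem_nhdsWithin_of_mem_nhds (Metric.isOpen_ball.mem_nhds hzr)] with y hy1 hy2 hyr
      rw [hV y hyr]
      exact max_lt hy1 hy2
    · rw [hV' z hzr] at ha
      -- Beyond radius `s` the maximum is just `U`, so no jump appears across the sphere.
      have h1 : ∀ᶠ y in 𝓝 z, s < dist y z₀ := by
        have hd : Continuous fun y => dist y z₀ := by fun_prop
        refine continuousAt_const.eventually_lt hd.continuousAt ?_
        rw [Metric.mem_ball, not_lt] at hzr
        linarith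
      filter_upwards [hU.usc z hz a ha, mem_nhdsWithin_of_mem_nhds h1] with y hy1 hy2
      by_cases hyr : y ∈ Metric.ball z₀ r
      · rw [hV y hyr, max_eq_left (hle y hyr hy2.le)]
        exact hy1
      · rw [hV' y hyr]
        exact hy1
  · by_cases hzr : z ∈ Metric.ball z₀ r
    · rw [hV z hzr]
      exact (max_lt (hU.ne_top z hz).lt_top (EReal.coe_lt_top _)).ne
    · rw [hV' z hzr]
      exact hU.ne_top z hz
  · obtain ⟨z, hz, hzb⟩ := hU.proper
    exact ⟨z, hz, fun h => hzb (le_bot_iff.1 (h ▸ hUV z))⟩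
  · obtain ⟨hψ2, hψz, hψle⟩ := hψ
    have hcase : V z = U z → f z ≤ lambdaOne (complexHessian ψ z) := fun h =>
      hU.test z hz ψ ⟨hψ2, hψz.trans h, hψle.mono fun y hy => (hUV y).trans hy⟩
    by_cases hzr : z ∈ Metric.ball z₀ r
    · rcases max_choice (U z) (χ z) with h | h
      · exact hcase ((hV z hzr).trans h)
      · rw [le_lambdaOne_iff hn hψ2]
        refine fun ξ => (hlevi z hzr ξ).trans
          (levi_le_levi_of_eventually_le (hχ z hzr) hψ2 ?_ ?_ ξ)
        · rw [hV z hzr, h] at hψz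
          exact EReal.coe_injective hψz
        · filter_upwards [hψle, Metric.isOpen_ball.mem_nhds hzr] with y hy hyr
          rw [hV y hyr] at hy
          exact_mod_cast (le_max_right _ _).trans hy
    · exact hcase (hV' z hzr)

/-- If `U` dominates the Perron family, its lower envelope is a supersolution. -/
lemma isSupersolution_lscEnvelope (hn : 1 ≤ n) (hΩ : IsOpen Ω) (hf : ContinuousOn f Ω)
    (hf_pos : ∀ z ∈ Ω, 0 < f z) (hhi : IsSupersolution Ω f hi) {U : Cn n → EReal}
    (hU : IsSubsolution Ω f U) (hUb : BoundedOn Ω U) (hUlohi : ∀ z ∈ Ω, lo z ≤ U z ∧ U z ≤ hi z)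
    (hmax : ∀ v ∈ perronFamily Ω f lo hi, ∀ z ∈ Ω, v z ≤ U z) :
    IsSupersolution Ω f (lscEnvelope Ω U) := by
  obtain ⟨M, hM⟩ := hUb
  refine ⟨lowerSemicontinuousOn_lscEnvelope, fun z hz h => ?_, ?_, fun z₀ hz₀ ψ hψ => ?_⟩
  · have h1 : ((-M : ℝ) : EReal) ≤ lscEnvelope Ω U z :=
      le_lscEnvelope_of_eventually (eventually_mem_nhdsWithin.mono fun y hy => (hM y hy).1)
    rw [h, le_bot_iff] at h1
    exact EReal.coe_ne_bot _ h1
  · obtain ⟨z, hz, -⟩ := hU.proper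
    refine ⟨z, hz, fun h => ?_⟩
    have h1 := (lscEnvelope_le hz (u := U)).trans (hM z hz).2
    rw [h, top_le_iff] at h1
    exact EReal.coe_ne_top _ h1
  · obtain ⟨hψ2, hψz₀, hψle⟩ := hψ
    by_contra! hlt
    have hlam : f z₀ < lambdaOne (complexHessian ψ z₀) :=
      (lt_max_iff.1 hlt).resolve_right (hf_pos z₀ hz₀).not_gt
    set c := lambdaOne (complexHessian ψ z₀) with hc
    have hcle := (le_lambdaOne_iff hn hψ2 c).1 le_rfl
    have hLhi : ∀ z ∈ Ω, lscEnvelope Ω U z ≤ hi z := fun z hz =>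
      (lscEnvelope_le hz).trans (hUlohi z hz).2
    -- Equality would make `ψ` a lower test function for `hi`, violating its supersolution property.
    -- The strict gap leaves room to raise `U`.
    have hψhi : (ψ z₀ : EReal) < hi z₀ := by
      refine lt_of_le_of_ne (hψz₀ ▸ hLhi z₀ hz₀) fun heq => ?_
      have := hhi.test z₀ hz₀ ψ ⟨hψ2, heq, by
        filter_upwards [hψle, hΩ.mem_nhds hz₀] with y hy hyΩ using hy.trans (hLhi y hyΩ)⟩
      exact hlt.not_ge this
    obtain ⟨b, hψb, hbhi⟩ := EReal.lt_iff_exists_real_btwn.1 hψhi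
    have hψb : ψ z₀ < b := by exact_mod_cast hψb
    -- One `γ` each for the variation of `f`, the variation of the Levi form and the quadratic term
    -- in `χ`.
    obtain ⟨γ, hγ, hγc⟩ : ∃ γ : ℝ, 0 < γ ∧ f z₀ + 3 * γ = c :=
      ⟨(c - f z₀) / 3, by linarith, by ring⟩
    obtain ⟨σ, hσ, hσb⟩ : ∃ σ : ℝ, 0 < σ ∧ ψ z₀ + 2 * σ = b :=
      ⟨(b - ψ z₀) / 2, by linarith, by ring⟩
    have hfz : ContinuousAt f z₀ := hf.continuousAt (hΩ.mem_nhds hz₀)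
    obtain ⟨r, hr, hball⟩ := Metric.eventually_nhds_iff_ball.1
      ((hψle.and (hΩ.mem_nhds hz₀)).and
      (((hψ2.eventually (by simp)).and (eventually_abs_levi_sub_le hψ2 hγ)).and
      ((hfz.eventually_lt continuousAt_const (show f z₀ < f z₀ + γ by linarith)).and
      ((hψ2.continuousAt.eventually_lt continuousAt_const
        (show ψ z₀ < ψ z₀ + σ by linarith)).and
      (eventually_lt_of_lowerSemicontinuousOn hΩ hhi.lsc hz₀ hbhi)))))
    -- `δ ≤ σ` keeps the bump below `b`, hence below `hi`; the other bound gives `χ ≤ ψ` from radius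
    -- `r / 2` outward.
    let δ := min σ (γ * (r / 2) ^ 2)
    have hδ : 0 < δ := lt_min hσ (by positivity)
    have hδσ : δ ≤ σ := min_le_left _ _
    have hδγ : δ ≤ γ * (r / 2) ^ 2 := min_le_right _ _
    let χ : Cn n → ℝ := fun x => ψ x + -γ * ‖x - z₀‖ ^ 2 + δ
    have hq := contDiff_norm_sub_sq z₀
    have hq' : ContDiff ℝ 2 fun x : Cn n => -γ * ‖x - z₀‖ ^ 2 := contDiff_const.mul hq
    have hχ2 : ∀ y ∈ Metric.ball z₀ r, ContDiffAt ℝ 2 χ y := fun y hy =>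
      ((hball y hy).2.1.1.add hq'.contDiffAt).add contDiffAt_const
    have hχlevi : ∀ y ∈ Metric.ball z₀ r, ∀ ξ, f y * ‖ξ‖ ^ 2 ≤ levi χ y ξ := by
      intro y hy ξ
      rw [levi_add_const, levi_add (hball y hy).2.1.1 hq'.contDiffAt,
        levi_const_mul _ hq.contDiffAt, levi_norm_sub_sq]
      have h1 := (abs_le.1 ((hball y hy).2.1.2 ξ)).1
      have h2 := hcle ξ
      have h3 : f y * ‖ξ‖ ^ 2 ≤ (c - 2 * γ) * ‖ξ‖ ^ 2 := by
        have := (hball y hy).2.2.1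
        gcongr
        linarith
      linarith
    have hχσ : ∀ y, χ y ≤ ψ y + σ := fun y => by
      have : 0 ≤ γ * ‖y - z₀‖ ^ 2 := by positivity
      simp only [χ]
      linarith
    have hχU : ∀ y ∈ Metric.ball z₀ r, r / 2 ≤ dist y z₀ → (χ y : EReal) ≤ U y := by
      intro y hy hyr
      refine le_trans ?_ ((hball y hy).1.1.trans (lscEnvelope_le (hball y hy).1.2))
      norm_cast
      rw [dist_eq_norm] at hyr
      have : γ * (r / 2) ^ 2 ≤ γ * ‖y - z₀‖ ^ 2 := by gcongr
      simp only [χ]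
      linarith
    classical
    let V : Cn n → EReal := fun y => if y ∈ Metric.ball z₀ r then max (U y) (χ y) else U y
    have hV : ∀ y ∈ Metric.ball z₀ r, V y = max (U y) (χ y) := fun y hy => if_pos hy
    have hV' : ∀ y ∉ Metric.ball z₀ r, V y = U y := fun y hy => if_neg hy
    have hVsub : IsSubsolution Ω f V :=
      hU.glue_ball hn (by linarith : r / 2 < r) hχ2 hχlevi hχU hV hV'
    have hχb : ∀ y ∈ Metric.ball z₀ r, χ y ≤ b := fun y hy => by
      have h1 := hχσ y
      have h2 := (hball y hy).2.2.2.1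
      linarith
    have hVU : ∀ y, U y ≤ V y := fun y => by
      by_cases hy : y ∈ Metric.ball z₀ r
      · rw [hV y hy]
        exact le_max_left _ _
      · rw [hV' y hy]
    have hVmem : V ∈ perronFamily Ω f lo hi := by
      refine ⟨hVsub, boundedOn_of_le (a := -M) (b := max M b) fun z hz =>
        ⟨(hM z hz).1.trans (hVU z), ?_⟩, fun z hz => ⟨(hUlohi z hz).1.trans (hVU z), ?_⟩⟩
      · by_cases hy : z ∈ Metric.ball z₀ r
        · rw [hV z hy]
          refine max_le ((hM z hz).2.trans ?_) ?_
          · exact_mod_cast le_max_left _ _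
          · exact_mod_cast (hχb z hy).trans (le_max_right _ _)
        · rw [hV' z hy]
          refine (hM z hz).2.trans ?_
          exact_mod_cast le_max_left _ _
      · by_cases hy : z ∈ Metric.ball z₀ r
        · rw [hV z hy]
          refine max_le (hUlohi z hz).2 (le_trans ?_ (hball z hy).2.2.2.2.le)
          exact_mod_cast hχb z hy
        · rw [hV' z hy]
          exact (hUlohi z hz).2
    have hz₀r : z₀ ∈ Metric.ball z₀ r := Metric.mem_ball_self hr
    have h1 : ∀ᶠ y in 𝓝 z₀, ψ z₀ + δ / 2 < χ y :=
      continuousAt_const.eventually_lt (hχ2 z₀ hz₀r).continuousAt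
        (by simp only [χ, sub_self, norm_zero]; linarith)
    -- Maximality of `U` gives `χ ≤ V ≤ U` near `z₀`, lifting the lower envelope above its value `ψ
    -- z₀`.
    have h2 : ((ψ z₀ + δ / 2 : ℝ) : EReal) ≤ lscEnvelope Ω U z₀ := by
      refine le_lscEnvelope_of_eventually (mem_nhdsWithin_of_mem_nhds ?_)
      filter_upwards [h1, Metric.ball_mem_nhds z₀ hr] with y hy hyr
      refine le_trans ?_ (hmax V hVmem y (hball y hyr).1.2)
      rw [hV y hyr]
      refine le_trans ?_ (le_max_right _ _)
      exact_mod_cast hy.le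
    rw [← hψz₀] at h2
    norm_cast at h2
    linarith

/-- The barrier `lo` may take the value `-∞`; its maximum with a smooth bounded subsolution repairs
this, and comparison keeps it below `hi`. -/
lemma exists_mem_perronFamily (hn : 1 ≤ n) (hΩ : IsOpen Ω) (hne : Ω.Nonempty)
    (hbdd : Bornology.IsBounded Ω) (hf : ContinuousOn f (closure Ω))
    (hφ : ContinuousOn φ (frontier Ω)) (hlo : IsSubsolution Ω f lo) (hhi : IsSupersolution Ω f hi)
    (hloφ : HasBoundaryValues Ω lo φ) (hhiφ : HasBoundaryValues Ω hi φ) :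
    (perronFamily Ω f lo hi).Nonempty := by
  obtain ⟨A, hA⟩ := hbdd.isCompact_closure.bddAbove_image hf
  obtain ⟨R, hR⟩ := hbdd.exists_norm_le
  have hcpt : IsCompact (frontier Ω) :=
    hbdd.isCompact_closure.of_isClosed_subset isClosed_frontier frontier_subset_closure
  obtain ⟨b, hb⟩ := hcpt.bddBelow_image hφ
  obtain ⟨B, hB⟩ := exists_forall_le_of_hasBoundaryValues hΩ hbdd hφ hlo.usc hlo.ne_top hloφ
  have hq : ContDiff ℝ 2 fun x : Cn n => ‖x‖ ^ 2 := by simpa using contDiff_norm_sub_sq (0 : Cn n)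
  have hq' : ContDiff ℝ 2 fun x : Cn n => |A| * ‖x‖ ^ 2 := contDiff_const.mul hq
  -- The factor `|A|` dominates `f`; the constant gives `q ≤ b - 1 < φ`, so boundary values are
  -- unaffected.
  let q : Cn n → ℝ := fun x => |A| * ‖x‖ ^ 2 + (b - 1 - |A| * R ^ 2)
  have hqsub : IsSubsolution Ω f (fun z => (q z : EReal)) := by
    refine isSubsolution_coe_of_levi hn hne (hq'.add contDiff_const) fun z hz ξ => ?_
    have hl : levi (fun x : Cn n => ‖x‖ ^ 2) z ξ = ‖ξ‖ ^ 2 := by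
      simpa using levi_norm_sub_sq (0 : Cn n) z ξ
    rw [levi_add_const, levi_const_mul _ hq.contDiffAt, hl]
    have := (hA (Set.mem_image_of_mem _ (subset_closure hz))).trans (le_abs_self A)
    gcongr
  have hqle : ∀ z ∈ Ω, q z ≤ b - 1 := fun z hz => by
    have : |A| * ‖z‖ ^ 2 ≤ |A| * R ^ 2 := by
      have := hR z hz
      gcongr
    simp only [q]
    linarith
  have hqge : ∀ z, b - 1 - |A| * R ^ 2 ≤ q z := fun z => by
    have : 0 ≤ |A| * ‖z‖ ^ 2 := by positivity
    simp only [q]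
    linarith
  have hvsub := hlo.sup hqsub
  have hvb : BoundedOn Ω fun z => max (lo z) (q z : EReal) :=
    boundedOn_of_le (a := b - 1 - |A| * R ^ 2) (b := max B (b - 1)) fun z hz => by
      refine ⟨le_trans ?_ (le_max_right _ _), max_le ((hB z hz).trans ?_) ?_⟩
      · exact_mod_cast hqge z
      · exact_mod_cast le_max_left _ _
      · exact_mod_cast (hqle z hz).trans (le_max_right _ _)
  have hvφ : HasBoundaryValues Ω (fun z => max (lo z) (q z : EReal)) φ := by
    intro ζ hζ
    refine (hloφ ζ hζ).congr' ?_
    have h1 : ((b - 1 : ℝ) : EReal) < φ ζ := by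
      have := hb (Set.mem_image_of_mem _ hζ)
      norm_cast
      linarith
    filter_upwards [(tendsto_order.1 (hloφ ζ hζ)).1 _ h1, self_mem_nhdsWithin] with z hz hzΩ
    refine (max_eq_left (le_trans ?_ hz.le)).symm
    exact_mod_cast hqle z hzΩ
  exact ⟨_, hvsub, hvb, fun z hz => ⟨le_max_left _ _,
    hvsub.le_of_hasBoundaryValues hn hΩ hbdd hf hvb hhi hvφ hhiφ z hz⟩⟩

/-- Common boundary values of the barriers. -/
lemma hasBoundaryValues_of_envelopes (hlo : ∀ ζ ∈ frontier Ω, lscEnvelope Ω lo ζ = (φ ζ : EReal))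
    (hhi : ∀ ζ ∈ frontier Ω, uscEnvelope Ω hi ζ = (φ ζ : EReal))
    (hord : ∀ ζ ∈ frontier Ω, uscEnvelope Ω lo ζ ≤ lscEnvelope Ω hi ζ) :
    HasBoundaryValues Ω lo φ ∧ HasBoundaryValues Ω hi φ := by
  refine ⟨fun ζ hζ => tendsto_of_envelopes_eq ?_ (hlo ζ hζ).ge,
    fun ζ hζ => tendsto_of_envelopes_eq (hhi ζ hζ).le ?_⟩
  -- At the boundary `φ = lo_* ≤ lo^* ≤ hi_* ≤ hi^* = φ`, so equality holds throughout.
  · exact (hord ζ hζ).trans ((lscEnvelope_le_uscEnvelope hζ.1).trans (hhi ζ hζ).le)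
  · exact (hlo ζ hζ).ge.trans ((lscEnvelope_le_uscEnvelope hζ.1).trans (hord ζ hζ))

lemma perronEnvelope_mem_perronFamily (hn : 1 ≤ n) (hΩ : IsOpen Ω) (hne : Ω.Nonempty)
    (hbdd : Bornology.IsBounded Ω) (hf : ContinuousOn f (closure Ω))
    (hf_pos : ∀ z ∈ closure Ω, 0 < f z)
    (hφ : ContinuousOn φ (frontier Ω)) (hlo : IsSubsolution Ω f lo) (hhi : IsSupersolution Ω f hi)
    (hloφ : HasBoundaryValues Ω lo φ) (hhiφ : HasBoundaryValues Ω hi φ) :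
    perronEnvelope Ω f lo hi ∈ perronFamily Ω f lo hi := by
  set F := perronFamily Ω f lo hi with hF
  set U := perronEnvelope Ω f lo hi with hU
  obtain ⟨v₀, hv₀⟩ := exists_mem_perronFamily hn hΩ hne hbdd hf hφ hlo hhi hloφ hhiφ
  have hle : ∀ v ∈ F, ∀ z, v z ≤ U z := fun v hv z =>
    le_iSup₂ (f := fun v (_ : v ∈ F) => v z) v hv
  have hlohi : ∀ z ∈ Ω, lo z ≤ U z ∧ U z ≤ hi z := fun z hz =>
    ⟨(hv₀.2.2 z hz).1.trans (hle v₀ hv₀ z), iSup₂_le fun v hv => (hv.2.2 z hz).2⟩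
  have hUφ : HasBoundaryValues Ω U φ := hloφ.of_between hhiφ hlohi
  obtain ⟨M, hM⟩ := hv₀.2.1
  have hcpt : IsCompact (frontier Ω) :=
    hbdd.isCompact_closure.of_isClosed_subset isClosed_frontier frontier_subset_closure
  obtain ⟨C, hC⟩ := hcpt.bddAbove_image hφ
  -- The bounds of individual members need not be uniform, so each is compared with the constant
  -- supersolution `C ≥ φ`.
  have hUC : ∀ z ∈ Ω, U z ≤ (C : EReal) := fun z hz => iSup₂_le fun v hv =>
    hv.1.le_supersolution hn hΩ hbdd hf hv.2.1
      (isSupersolution_const hn hne (fun z hz => hf_pos z (subset_closure hz)) C)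
      (fun ζ hζ => ⟨C, fun a ha => by
        have hvφ : HasBoundaryValues Ω v φ := hloφ.of_between hhiφ hv.2.2
        refine (tendsto_order.1 (hvφ ζ hζ)).2 a ?_
        exact_mod_cast (hC (Set.mem_image_of_mem _ hζ)).trans_lt ha,
        fun a ha => .of_forall fun z => by exact_mod_cast ha⟩) z hz
  have hU'b : ∀ z ∈ Ω, ((-M : ℝ) : EReal) ≤ uscEnvelope Ω U z ∧ uscEnvelope Ω U z ≤ (C : EReal) :=
    fun z hz => ⟨(hM z hz).1.trans ((hle v₀ hv₀ z).trans (le_uscEnvelope hz)),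
      uscEnvelope_le_of_eventually (eventually_mem_nhdsWithin.mono hUC)⟩
  have hU'sub : IsSubsolution Ω f (uscEnvelope Ω U) := by
    refine isSubsolution_uscEnvelope_iSup hn hΩ (hf.mono subset_closure) (fun v hv => hv.1)
      (fun z hz => ne_top_of_le_ne_top (EReal.coe_ne_top C) (hU'b z hz).2) ?_
    obtain ⟨z, hz⟩ := hne
    exact ⟨z, hz, ne_bot_of_le_ne_bot (EReal.coe_ne_bot (-M)) (hU'b z hz).1⟩
  -- Comparison is needed since `hi` is only lower semicontinuous: `U ≤ hi` does not by itself pass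
  -- to the upper envelope.
  have hU'mem : uscEnvelope Ω U ∈ F :=
    ⟨hU'sub, boundedOn_of_le hU'b, fun z hz => ⟨(hlohi z hz).1.trans (le_uscEnvelope hz),
      hU'sub.le_of_hasBoundaryValues hn hΩ hbdd hf (boundedOn_of_le hU'b) hhi hUφ.uscEnvelope hhiφ
        z hz⟩⟩
  have heq : Set.EqOn U (uscEnvelope Ω U) Ω := fun z hz =>
    le_antisymm (le_uscEnvelope hz) (hle _ hU'mem z)
  refine ⟨hU'sub.congr hΩ heq, boundedOn_of_le (a := -M) (b := C) fun z hz => ?_, hlohi⟩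
  rw [heq hz]
  exact hU'b z hz

end Perron

end FirstEigenvalue

end

/-! ### Existence, boundary values and uniqueness. -/

theorem theorem3 (n : ℕ) (hn : 1 ≤ n)
    (Ω : Set (FirstEigenvalue.Cn n)) (hΩ_open : IsOpen Ω) (hΩ_conn : IsConnected Ω)
    (hΩ_bdd : Bornology.IsBounded Ω)
    (f : FirstEigenvalue.Cn n → ℝ) (hf_cont : ContinuousOn f (closure Ω))
    (hf_pos : ∀ z ∈ closure Ω, 0 < f z)
    (φ : FirstEigenvalue.Cn n → ℝ) (hφ : ContinuousOn φ (frontier Ω))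
    (lo hi : FirstEigenvalue.Cn n → EReal)
    (hlo : FirstEigenvalue.IsSubsolution Ω f lo)
    (hhi : FirstEigenvalue.IsSupersolution Ω f hi)
    (hlo_bdry : ∀ ζ ∈ frontier Ω, FirstEigenvalue.lscEnvelope Ω lo ζ = (φ ζ : EReal))
    (hhi_bdry : ∀ ζ ∈ frontier Ω, FirstEigenvalue.uscEnvelope Ω hi ζ = (φ ζ : EReal))
    (hord : ∀ ζ ∈ frontier Ω,
      FirstEigenvalue.uscEnvelope Ω lo ζ ≤ FirstEigenvalue.lscEnvelope Ω hi ζ) :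
    FirstEigenvalue.IsSolution Ω f (FirstEigenvalue.perronEnvelope Ω f lo hi) ∧
    FirstEigenvalue.HasBoundaryValues Ω (FirstEigenvalue.perronEnvelope Ω f lo hi) φ ∧
    ∀ w : FirstEigenvalue.Cn n → EReal,
      FirstEigenvalue.IsSolution Ω f w → FirstEigenvalue.HasBoundaryValues Ω w φ →
      Set.EqOn w (FirstEigenvalue.perronEnvelope Ω f lo hi) Ω := by
  obtain ⟨hloφ, hhiφ⟩ :=
    FirstEigenvalue.hasBoundaryValues_of_envelopes hlo_bdry hhi_bdry hord
  have hmem := FirstEigenvalue.perronEnvelope_mem_perronFamily hn hΩ_open hΩ_conn.nonempty hΩ_bdd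
    hf_cont hf_pos hφ hlo hhi hloφ hhiφ
  set U := FirstEigenvalue.perronEnvelope Ω f lo hi with hU
  obtain ⟨hUsub, hUb, hUlohi⟩ := hmem
  have hUφ : FirstEigenvalue.HasBoundaryValues Ω U φ := hloφ.of_between hhiφ hUlohi
  have hLsup := FirstEigenvalue.isSupersolution_lscEnvelope hn hΩ_open
    (hf_cont.mono subset_closure) (fun z hz => hf_pos z (subset_closure hz)) hhi hUsub hUb hUlohi
    fun v hv z _ => le_iSup₂ (f := fun v (_ : v ∈ FirstEigenvalue.perronFamily Ω f lo hi) => v z)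
      v hv
  -- Both functions tend to `φ`, so comparison reverses the trivial inequality between `U` and its
  -- lower envelope.
  have hUL : Set.EqOn U (FirstEigenvalue.lscEnvelope Ω U) Ω := fun z hz =>
    le_antisymm (hUsub.le_of_hasBoundaryValues hn hΩ_open hΩ_bdd hf_cont hUb hLsup hUφ
      hUφ.lscEnvelope z hz) (FirstEigenvalue.lscEnvelope_le hz)
  have hUsup : FirstEigenvalue.IsSupersolution Ω f U := hLsup.congr hΩ_open hUL
  refine ⟨⟨hUsub, hUsup⟩, hUφ, fun w hw hwφ z hz => ?_⟩
  -- Comparison requires a bounded subsolution; semicontinuity on compact sets and the boundary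
  -- limits bound `w` on both sides.
  obtain ⟨B, hB⟩ := FirstEigenvalue.exists_forall_le_of_hasBoundaryValues hΩ_open hΩ_bdd hφ
    hw.1.usc hw.1.ne_top hwφ
  obtain ⟨A, hA⟩ := FirstEigenvalue.exists_forall_ge_of_hasBoundaryValues hΩ_open hΩ_bdd hφ
    hw.2.lsc hw.2.ne_bot hwφ
  exact le_antisymm
    (hw.1.le_of_hasBoundaryValues hn hΩ_open hΩ_bdd hf_cont
      (FirstEigenvalue.boundedOn_of_le fun z hz => ⟨hA z hz, hB z hz⟩) hUsup hwφ hUφ z hz)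
    (hUsub.le_of_hasBoundaryValues hn hΩ_open hΩ_bdd hf_cont hUb hw.2 hUφ hwφ z hz)
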